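/- **Setting.** Let $d\in\{2,3\}$ and let $\Omega\subset\mathbb R^d$ be a bounded domain. A decomposition of $\Omega$ consists of $N$ patches $\Omega_i^*\subset\Omega$, where $\Omega_i^*=\Phi_i((0,1)^d)$ and $\Phi_i$ is a tensor-product B-spline map of degree $p$ (with its own knot vectors), one-to-one and $C^1$ on $[0,1]^d$, with $|\det D\Phi_i|$ bounded above and bounded away from $0$. Some pairs of patches are separated by a gap region, some pairs overlap, and $\overline\Omega$ is the union of the closed patches and the closed gap regions. * A gap region $\Omega_{gij}$ is disjoint from the patches, meets $\partial\Omega$ in a set of $(d-1)$-dimensional measure $0$, and $\partial\Omega_{gij}=F_{gi}\cup F_{gj}$ with $F_{gi}\subset\partial\Omega_i^*$ planar and compact, with unit normal $n$ exterior to $\Omega_i^*$, and $F_{gj}=\Phi_{gij}(F_{gi})\subset\partial\Omega_j^*$, $\Phi_{gij}(x)=x+\zeta(x)n$, $\zeta\ge 0$; $\Phi_{gji}=\Phi_{gij}^{-1}$. The gap is the open region between the two faces. * For overlapping patches, $\partial(\Omega_i^*\cap\Omega_j^*)$ is the closure of $F_{oij}\cup F_{oji}$, where $F_{oij}=\partial\Omega_i^*\cap\Omega_j^*$;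 the face $F_{oij}$ of one of the two patches is planar with exterior unit normal $n$, $F_{oji}=\Phi_{oij}(F_{oij})$ with $\Phi_{oij}(x)=x+\zeta(x)n$, $\zeta\le 0$, and $\Phi_{oji}=\Phi_{oij}^{-1}$. * The remaining interior faces are the matching interfaces $F_{ij}$, i.e. the part of $\partial\Omega_i^*\cap\partial\Omega_j^*$ that lies in $\Omega$ and outside of $\overline{\Omega_i^*\cap\Omega_j^*}$. All height functions $\zeta$ are Lipschitz with constant at most $M$. Let $h$ be the maximal diameter of the micro elements (in the parameter domain) of the patches. The gap and overlap widths $\max|\zeta|$ are at most $h^\lambda$, where $\lambda\ge 1$. Let $\rho_1,\dots,\rho_N>0$ be the patchwise constant diffusion coefficients. On a face between two patches $i,j$ (matching, or of an overlap) $\{\rho\}=(\rho_i+\rho_j)/2$. On a face $F_{gk}$ ($k\in\{i,j\}$) of a gap, $\{\rho\}=(\rho_{gij}+\rho_k)/2$, where the coefficient in the gap is $\rho_{gij}=\rho_j$, $j$ being the patch with the non-planar face. $V_h$ is the space of functions which on each $\Omega_i^*$ are of the form $B\circ\Phi_i^{-1}$ with $B$ in the spline space of the patch. For $\ell\ge2$,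 $V^*$ is the space of functions $v$ with $v_i\in H^\ell(\Omega_i^*)$ for all $i$ and with values $v_{gij}\in H^\ell(\Omega_{gij})$ on the gap regions, whose jumps vanish on all interior faces (on a gap face: the jump between $v_i$ and $v_{gij}$). On $V^*+V_h$ let $$\|v\|_{dG}^2=\sum_i\Big(\rho_i\|\nabla v_i\|^2_{L^2(\Omega_i^*)}+\tfrac{\rho_i}{h}\|v_i\|^2_{L^2(\partial\Omega_i^*\cap\partial\Omega)}+\sum_{F_{gi}}\tfrac{\{\rho\}}{h}\|v_i\|^2_{L^2(F_{gi})}+\sum_{F_{oij}}\tfrac{\{\rho\}}{h}\|v_i\|^2_{L^2(F_{oij})}+\sum_{F_{ij}}\tfrac{\{\rho\}}{h}\|v_i-v_j\|^2_{L^2(F_{ij})}\Big),$$ the inner sums being over the faces of $\Omega_i^*$ of each type. For $\eta>0$ let $$B_h(u,\phi)=\sum_i\Big(\int_{\Omega_i^*}\rho_i\nabla u_i\cdot\nabla\phi_i\,dx-\int_{\partial\Omega_i^*\cap\partial\Omega}\rho_i\nabla u_i\cdot n\,\phi_i\,d\sigma+\frac{\eta\rho_i}{h}\int_{\partial\Omega_i^*\cap\partial\Omega}u_i\phi_i\,d\sigma-\sum_{F}\int_F\Big[\big(\tfrac{\rho_i}2\nabla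 u_i+\tfrac{\rho_j}2\nabla u_j\big)\cdot n\,\phi_i-\frac{\eta\{\rho\}}h(u_i-u_j)\phi_i\Big]d\sigma\Big),$$ where $F$ runs through all interior faces (gap, overlap, matching) of $\Omega_i^*$, $n$ is the unit normal exterior to $\Omega_i^*$, $j$ is the patch on the other side and, on gap and overlap faces, $u_j$ and $\nabla u_j$ are evaluated at the opposite point, i.e. composed with $\Phi_{gij}$ resp. $\Phi_{oij}$. For $v\in V^*$ put $$\mathcal K_{g,o}(v)=\sum_{\Omega'}\Big(\|\nabla v\|_{L^2(\partial\Omega')}+\big\|\textstyle\sum_{|\alpha|=2}|D^\alpha v|\big\|_{L^2(\Omega')}\Big),$$ where $\Omega'$ runs through the gap regions (with $v=v_{gij}$) and the overlapping regions $\Omega_i^*\cap\Omega_j^*$ (with one summand for $v_i$ and one for $v_j$). **Claim.** There is a constant $C\ge 0$ that depends only on $\eta$, on $\rho=(\rho_1,\dots,\rho_N)$, on $d$ and on the bound $M$ for the slopes of the face maps (in particular it does not depend on $h$, $p$, $\ell$, $\lambda$ or the decomposition) such that for all $u=v+w$ with $v\in V^*$, $w\in V_h$, and all $\phi_h\in V_h$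 $$B_h(u,\phi_h)\le C\Big(\big(\|u\|_{dG}^2+\sum_{i=1}^N\rho_i h\|\nabla u_i\|^2_{L^2(\partial\Omega_i^*)}\big)^{1/2}+\mathcal K_{g,o}(v)\,\big(h^{\lambda+1}+h^{\lambda-1/2}\big)\Big)\|\phi_h\|_{dG}.$$ -/

import Mathlib

open MeasureTheory Set Filter Topology
open scoped ENNReal NNReal ContDiff BigOperators

noncomputable section

namespace NonMatchingDG

/-- Euclidean space of dimension `d`. -/
abbrev E (d : ℕ) : Type := EuclideanSpace ℝ (Fin d)

/-- The `(d-1)`-dimensional surface measure on `ℝ^d` (normalised Hausdorff measure). -/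
abbrev surf (d : ℕ) : Measure (E d) := Measure.euclideanHausdorffMeasure (d - 1)

/-! ### Weak derivatives, Sobolev spaces, traces, normals -/

/-- `g` is the weak partial derivative of `f` in the `k`-th direction on the open set `U`. -/
def HasWeakPartial {d : ℕ} (U : Set (E d)) (k : Fin d) (f g : E d → ℝ) : Prop :=
  LocallyIntegrableOn f U ∧ LocallyIntegrableOn g U ∧
    ∀ ψ : E d → ℝ, ContDiff ℝ ∞ ψ → HasCompactSupport ψ → tsupport ψ ⊆ U →
      ∫ x in U, f x * fderiv ℝ ψ x (EuclideanSpace.single k 1) = -∫ x in U, g x * ψ x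

/-- Membership in the Sobolev space `H^m(U)`. -/
def MemH {d : ℕ} (U : Set (E d)) : ℕ → (E d → ℝ) → Prop
  | 0, f => MemLp f 2 (volume.restrict U)
  | m + 1, f => MemLp f 2 (volume.restrict U) ∧
      ∀ k : Fin d, ∃ g : E d → ℝ, HasWeakPartial U k f g ∧ MemH U m g

open Classical in
/-- The weak partial derivative on `U` (zero if there is none); it is unique up to null sets. -/
def weakPartial {d : ℕ} (U : Set (E d)) (k : Fin d) (f : E d → ℝ) : E d → ℝ :=
  if h : ∃ g, HasWeakPartial U k f g then h.choose else 0

/-- The weak gradient on `U`. -/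
def weakGrad {d : ℕ} (U : Set (E d)) (f : E d → ℝ) (x : E d) : E d :=
  WithLp.toLp 2 fun k => weakPartial U k f x

/-- The trace of `f` at `x`, taken from `U`: the limit of the means of `f` over `B(x, r) ∩ U` as
`r → 0` along `r = 1 / (n + 1)`. For a Sobolev function on a Lipschitz set this agrees with the
usual trace at almost every boundary point (and with the function itself inside `U`); for a
function that is continuous up to `x` it is the limit value. -/
def trace {d : ℕ} {F : Type} [NormedAddCommGroup F] [NormedSpace ℝ F]
    (U : Set (E d)) (f : E d → F) (x : E d) : F :=
  limUnder atTop fun n : ℕ => ⨍ y in Metric.ball x (1 / ((n : ℝ) + 1)) ∩ U, f y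

/-- `n` is the outer unit normal of `U` at `x`: near `x`, the set `U` contains every open cone
around `-n` and misses every open cone around `n` of aperture less than a half space. -/
def IsOuterUnitNormal {d : ℕ} (U : Set (E d)) (x n : E d) : Prop :=
  ‖n‖ = 1 ∧ ∀ ε : ℝ, 0 < ε → ∀ᶠ y in 𝓝 x,
    (inner ℝ n (y - x) < -ε * ‖y - x‖ → y ∈ U) ∧ (ε * ‖y - x‖ < inner ℝ n (y - x) → y ∉ U)

open Classical in
/-- The outer unit normal of `U` at `x` (zero at points where there is none). -/
def outerNormal {d : ℕ} (U : Set (E d)) (x : E d) : E d :=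
  if h : ∃ n, IsOuterUnitNormal U x n then h.choose else 0

open Classical in
/-- The unit normal at `x` of the common face of `U` and `V`, directed from `U` towards `V`. -/
def interfaceNormal {d : ℕ} (U V : Set (E d)) (x : E d) : E d :=
  if h : ∃ n, IsOuterUnitNormal U x n ∧ IsOuterUnitNormal V x (-n) then h.choose else 0

/-- `‖f‖²` in `L²(S)`, for a surface `S`. -/
def surfSq {d : ℕ} {F : Type} [NormedAddCommGroup F] (S : Set (E d)) (f : E d → F) : ℝ≥0∞ :=
  ∫⁻ x in S, ‖f x‖ₑ ^ 2 ∂(surf d)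

/-- `‖f‖²` in `L²(U)`, for a subset `U` of `ℝ^d`. -/
def volSq {d : ℕ} {F : Type} [NormedAddCommGroup F] (U : Set (E d)) (f : E d → F) : ℝ≥0∞ :=
  ∫⁻ x in U, ‖f x‖ₑ ^ 2

/-! ### B-splines and patches -/

/-- A knot vector `0 = ξ₀ ≤ ξ₁ ≤ … ≤ ξ_{n+p} = 1` for `n` B-splines of degree `p`
(only the entries with index at most `n + p` matter). -/
structure KnotVector (p : ℕ) where
  n : ℕ
  knot : ℕ → ℝ
  mono : MonotoneOn knot (Set.Iic (n + p))
  knot_first : knot 0 = 0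
  knot_last : knot (n + p) = 1

/-- The Cox-de Boor recursion, with the usual convention `0 / 0 = 0`. -/
def bspline (ξ : ℕ → ℝ) : ℕ → ℕ → ℝ → ℝ
  | 0, j, t => Set.indicator (Set.Ico (ξ j) (ξ (j + 1))) (fun _ => 1) t
  | q + 1, j, t =>
      (t - ξ j) / (ξ (j + q + 1) - ξ j) * bspline ξ q j t +
        (ξ (j + q + 2) - t) / (ξ (j + q + 2) - ξ (j + 1)) * bspline ξ q (j + 1) t

/-- The parametric domain `(0,1)^d`. -/
def openCube (d : ℕ) : Set (E d) := {x | ∀ k, x k ∈ Set.Ioo (0 : ℝ) 1}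

/-- The closed unit cube `[0,1]^d`. -/
def closedCube (d : ℕ) : Set (E d) := {x | ∀ k, x k ∈ Set.Icc (0 : ℝ) 1}

/-- Indices of the tensor-product B-spline basis. -/
abbrev BIndex {d p : ℕ} (Ξ : Fin d → KnotVector p) : Type := (k : Fin d) → Fin (Ξ k).n

/-- The tensor-product B-splines. -/
def tensorBSpline {d p : ℕ} (Ξ : Fin d → KnotVector p) (J : BIndex Ξ) (x : E d) : ℝ :=
  ∏ k, bspline (Ξ k).knot p (J k) (x k)

/-- The spline with coefficients (or control points) `c`. -/
def spline {d p : ℕ} {F : Type} [AddCommGroup F] [Module ℝ F] (Ξ : Fin d → KnotVector p)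
    (c : BIndex Ξ → F) (x : E d) : F :=
  ∑ J, tensorBSpline Ξ J x • c J

/-- The micro elements of the mesh that the knots form in the parametric domain. -/
def microElement {d p : ℕ} (Ξ : Fin d → KnotVector p) (m : (k : Fin d) → Fin ((Ξ k).n + p)) :
    Set (E d) :=
  {x | ∀ k, x k ∈ Set.Ioo ((Ξ k).knot (m k)) ((Ξ k).knot ((m k : ℕ) + 1))}

/-- The largest diameter of a micro element. -/
def meshSize {d p : ℕ} (Ξ : Fin d → KnotVector p) : ℝ := ⨆ m, Metric.diam (microElement Ξ m)

/-- A patch: knot vectors and a B-spline parametrization `Φ` of degree `p` of the patch over the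
unit cube, `C¹` up to the boundary, one-to-one, with `c ≤ |det DΦ| ≤ C` for some `0 < c < C`. -/
structure Patch (d p : ℕ) where
  knots : Fin d → KnotVector p
  ctrl : BIndex knots → E d
  param : E d → E d
  param_eq : ∀ x ∈ openCube d, param x = spline knots ctrl x
  smooth : ContDiffOn ℝ 1 param (closedCube d)
  inj : Set.InjOn param (closedCube d)
  det_bounds : ∃ c C : ℝ, 0 < c ∧ c < C ∧
    ∀ x ∈ openCube d, c ≤ |(fderiv ℝ param x).det| ∧ |(fderiv ℝ param x).det| ≤ C

/-- The open subset of `ℝ^d` covered by a patch. -/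
def Patch.region {d p : ℕ} (P : Patch d p) : Set (E d) := P.param '' openCube d

/-- Functions `f` on the patch `P` of the form `B ∘ Φ⁻¹` with a spline `B`
(values outside of the patch are irrelevant). -/
def Patch.IsSpline {d p : ℕ} (P : Patch d p) (f : E d → ℝ) : Prop :=
  ∃ c : BIndex P.knots → ℝ, ∀ x ∈ openCube d, f (P.param x) = spline P.knots c x

/-! ### Gaps, overlaps and decompositions -/

/-- A pair of opposite faces of a gap or of an overlapping region: a planar (simple) face `base`
with unit normal `normal`, and the face of all points `x + ζ(x) n`, `x ∈ base`. -/
structure OppositeFaces (d : ℕ) where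
  base : Set (E d)
  normal : E d
  offset : ℝ
  height : E d → ℝ
  norm_normal : ‖normal‖ = 1
  planar : ∀ x ∈ base, inner ℝ normal x = offset

namespace OppositeFaces

variable {d : ℕ} (F : OppositeFaces d)

/-- The map `x ↦ x + ζ(x) n` from the planar face to the opposite face. -/
def toOpp (x : E d) : E d := x + F.height x • F.normal

/-- The face opposite to the planar face. -/
def opp : Set (E d) := F.toOpp '' F.base

/-- The inverse of `toOpp`, that is the orthogonal projection to the plane of `base`. -/
def toBase (y : E d) : E d := y - (inner ℝ F.normal y - F.offset) • F.normal

/-- The open region between the two faces, if the height is nonnegative. -/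
def between : Set (E d) :=
  {y | ∃ x ∈ F.base, ∃ t : ℝ, 0 < t ∧ t < F.height x ∧ y = x + t • F.normal}

theorem toBase_toOpp {x : E d} (hx : x ∈ F.base) : F.toBase (F.toOpp x) = x := by
  have h1 : inner ℝ F.normal F.normal = (1 : ℝ) := by
    rw [real_inner_self_eq_norm_sq, F.norm_normal]; norm_num
  rw [toBase, toOpp, inner_add_right, inner_smul_right, h1, F.planar x hx]
  simp

end OppositeFaces

/-- A decomposition of the bounded domain `Ω` into `N` patches, possibly with gaps and overlaps.
`gaps` and `overlaps` list the pairs `(i, j)` of patches that are separated by a gap, or that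
overlap, where `i` is the patch that has the planar face. -/
structure Decomposition (d N p : ℕ) where
  Ω : Set (E d)
  isOpen_Ω : IsOpen Ω
  isConnected_Ω : IsConnected Ω
  bounded_Ω : Bornology.IsBounded Ω
  patch : Fin N → Patch d p
  patch_subset : ∀ i, (patch i).region ⊆ Ω
  gaps : Finset (Fin N × Fin N)
  gapFaces : Fin N × Fin N → OppositeFaces d
  overlaps : Finset (Fin N × Fin N)
  overlapFaces : Fin N × Fin N → OppositeFaces d
  closure_Ω : closure Ω =
    (⋃ i, closure (patch i).region) ∪ ⋃ e ∈ gaps, closure (gapFaces e).between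
  -- gap regions
  gap_ne : ∀ e ∈ gaps, e.1 ≠ e.2 ∧ (e.2, e.1) ∉ gaps
  gap_compact : ∀ e ∈ gaps, IsCompact (gapFaces e).base
  gap_base : ∀ e ∈ gaps, (gapFaces e).base ⊆ frontier (patch e.1).region
  gap_opp : ∀ e ∈ gaps, (gapFaces e).opp ⊆ frontier (patch e.2).region
  gap_height : ∀ e ∈ gaps, ∀ x ∈ (gapFaces e).base, 0 ≤ (gapFaces e).height x
  gap_normal : ∀ e ∈ gaps, ∀ᵐ x ∂(surf d).restrict (gapFaces e).base,
    IsOuterUnitNormal (patch e.1).region x (gapFaces e).normal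
  gap_isOpen : ∀ e ∈ gaps, IsOpen (gapFaces e).between
  gap_frontier : ∀ e ∈ gaps,
    frontier (gapFaces e).between = (gapFaces e).base ∪ (gapFaces e).opp
  gap_boundary : ∀ e ∈ gaps, surf d (frontier (gapFaces e).between ∩ frontier Ω) = 0
  gap_disjoint : ∀ e ∈ gaps, ∀ i, Disjoint (gapFaces e).between (patch i).region
  -- overlapping regions
  overlap_iff : ∀ i j, i ≠ j →
    (((patch i).region ∩ (patch j).region).Nonempty ↔ (i, j) ∈ overlaps ∨ (j, i) ∈ overlaps)
  overlap_ne : ∀ e ∈ overlaps, e.1 ≠ e.2 ∧ (e.2, e.1) ∉ overlaps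
  overlap_base : ∀ e ∈ overlaps,
    (overlapFaces e).base = frontier (patch e.1).region ∩ (patch e.2).region
  overlap_opp : ∀ e ∈ overlaps,
    (overlapFaces e).opp = frontier (patch e.2).region ∩ (patch e.1).region
  overlap_height : ∀ e ∈ overlaps, ∀ x ∈ (overlapFaces e).base, (overlapFaces e).height x ≤ 0
  overlap_normal : ∀ e ∈ overlaps, ∀ᵐ x ∂(surf d).restrict (overlapFaces e).base,
    IsOuterUnitNormal (patch e.1).region x (overlapFaces e).normal
  overlap_frontier : ∀ e ∈ overlaps, frontier ((patch e.1).region ∩ (patch e.2).region) =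
    closure ((overlapFaces e).base ∪ (overlapFaces e).opp)

namespace Decomposition

variable {d N p : ℕ} (D : Decomposition d N p)

/-- The open set `Ω_i^*` of the `i`-th patch. -/
def reg (i : Fin N) : Set (E d) := (D.patch i).region

/-- The gap region between the patches of the pair `e`. -/
def gapRegion (e : Fin N × Fin N) : Set (E d) := (D.gapFaces e).between

/-- The part of the boundary of the `i`-th patch on the boundary of the domain. -/
def outerBdry (i : Fin N) : Set (E d) := frontier (D.reg i) ∩ frontier D.Ω

/-- The matching interior interface of the patches `i` and `j`. -/
def matching (i j : Fin N) : Set (E d) :=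
  (frontier (D.reg i) ∩ frontier (D.reg j) ∩ D.Ω) \ closure (D.reg i ∩ D.reg j)

/-- The mesh size `h`, the maximum of the mesh sizes of the patches. -/
def h : ℝ := ⨆ i, meshSize (D.patch i).knots

/-- The slopes of the face maps of all gaps and overlaps are at most `M`. -/
def SlopeLE (M : ℝ≥0) : Prop :=
  (∀ e ∈ D.gaps, LipschitzOnWith M (D.gapFaces e).height (D.gapFaces e).base) ∧
  (∀ e ∈ D.overlaps, LipschitzOnWith M (D.overlapFaces e).height (D.overlapFaces e).base)

/-- The widths of all gaps and overlaps, i.e. the maximal distance of opposite points, are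
at most `r`. -/
def WidthLE (r : ℝ) : Prop :=
  (∀ e ∈ D.gaps, ∀ x ∈ (D.gapFaces e).base, dist x ((D.gapFaces e).toOpp x) ≤ r) ∧
  (∀ e ∈ D.overlaps, ∀ x ∈ (D.overlapFaces e).base, dist x ((D.overlapFaces e).toOpp x) ≤ r)

/-- The space `V_h`: patchwise splines. -/
def MemVh (w : Fin N → E d → ℝ) : Prop := ∀ i, (D.patch i).IsSpline (w i)

/-- The space `V^*`: patchwise `H^ℓ` functions `v i`, together with their values `vg e` on the
gap regions, without jumps across the interior faces (matching interfaces, gap faces, and faces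
of overlapping regions). -/
structure MemVstar (ℓ : ℕ) (v : Fin N → E d → ℝ) (vg : Fin N × Fin N → E d → ℝ) : Prop where
  sobolev : ∀ i, MemH (D.reg i) ℓ (v i)
  sobolev_gap : ∀ e ∈ D.gaps, MemH (D.gapRegion e) ℓ (vg e)
  jump_matching : ∀ i j, i ≠ j → ∀ᵐ x ∂(surf d).restrict (D.matching i j),
    trace (D.reg i) (v i) x = trace (D.reg j) (v j) x
  jump_gap_base : ∀ e ∈ D.gaps, ∀ᵐ x ∂(surf d).restrict (D.gapFaces e).base,
    trace (D.reg e.1) (v e.1) x = trace (D.gapRegion e) (vg e) x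
  jump_gap_opp : ∀ e ∈ D.gaps, ∀ᵐ x ∂(surf d).restrict (D.gapFaces e).opp,
    trace (D.reg e.2) (v e.2) x = trace (D.gapRegion e) (vg e) x
  jump_overlap_base : ∀ e ∈ D.overlaps, ∀ᵐ x ∂(surf d).restrict (D.overlapFaces e).base,
    trace (D.reg e.1) (v e.1) x = trace (D.reg e.2) (v e.2) x
  jump_overlap_opp : ∀ e ∈ D.overlaps, ∀ᵐ x ∂(surf d).restrict (D.overlapFaces e).opp,
    trace (D.reg e.1) (v e.1) x = trace (D.reg e.2) (v e.2) x

end Decomposition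

/-- A patchwise function together with its patchwise gradient. -/
structure BrokenFun (d N : ℕ) where
  val : Fin N → E d → ℝ
  grad : Fin N → E d → E d

/-- A function in `V_h`, with its classical gradient. -/
def BrokenFun.ofSpline {d N : ℕ} (w : Fin N → E d → ℝ) : BrokenFun d N where
  val := w
  grad i := gradient (w i)

namespace Decomposition

variable {d N p : ℕ} (D : Decomposition d N p)

/-- The function `v + w` with `v` in `V^*` (weak gradient on each patch) and `w` in `V_h`
(classical gradient, which exists almost everywhere on each patch). -/
def sum (v w : Fin N → E d → ℝ) : BrokenFun d N where
  val i x := v i x + w i x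
  grad i x := weakGrad (D.reg i) (v i) x + gradient (w i) x

/-- Boundary values of the `i`-th component. -/
def tr (u : BrokenFun d N) (i : Fin N) : E d → ℝ := trace (D.reg i) (u.val i)

/-- Boundary values of the gradient of the `i`-th component. -/
def trGrad (u : BrokenFun d N) (i : Fin N) : E d → E d := trace (D.reg i) (u.grad i)

/-- The average of `ρ` across the planar face of a gap of the pair `e = (i, j)`. The planar face
is the physical interface, so that the coefficient in the gap is `ρ j`. -/
def gapAvgBase (ρ : Fin N → ℝ) (e : Fin N × Fin N) : ℝ := (ρ e.2 + ρ e.1) / 2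

/-- The average of `ρ` across the other face of the gap. -/
def gapAvgOpp (ρ : Fin N → ℝ) (e : Fin N × Fin N) : ℝ := (ρ e.2 + ρ e.2) / 2

/-- The average of `ρ` across a face of an overlapping region or a matching interface. -/
def avg (ρ : Fin N → ℝ) (i j : Fin N) : ℝ := (ρ i + ρ j) / 2

/-- The square of the dG norm. -/
def dGSq (ρ : Fin N → ℝ) (v : BrokenFun d N) : ℝ≥0∞ :=
  ∑ i, (ENNReal.ofReal (ρ i) * volSq (D.reg i) (v.grad i) +
      ENNReal.ofReal (ρ i / D.h) * surfSq (D.outerBdry i) (D.tr v i)) +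
  ∑ e ∈ D.gaps,
    (ENNReal.ofReal (gapAvgBase ρ e / D.h) * surfSq (D.gapFaces e).base (D.tr v e.1) +
      ENNReal.ofReal (gapAvgOpp ρ e / D.h) * surfSq (D.gapFaces e).opp (D.tr v e.2)) +
  ∑ e ∈ D.overlaps,
    (ENNReal.ofReal (avg ρ e.1 e.2 / D.h) * surfSq (D.overlapFaces e).base (D.tr v e.1) +
      ENNReal.ofReal (avg ρ e.1 e.2 / D.h) * surfSq (D.overlapFaces e).opp (D.tr v e.2)) +
  ∑ i, ∑ j ∈ Finset.univ.erase i, ENNReal.ofReal (avg ρ i j / D.h) *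
      surfSq (D.matching i j) (fun x => D.tr v i x - D.tr v j x)

/-- The sum of `ρ_i h ‖∇u_i‖²` in `L²(∂Ω_i^*)`. -/
def fluxSq (ρ : Fin N → ℝ) (u : BrokenFun d N) : ℝ≥0∞ :=
  ∑ i, ENNReal.ofReal (ρ i * D.h) * surfSq (frontier (D.reg i)) (D.trGrad u i)

/-- The face integral `∫_S (½ρ_i ∇u_i + ½ρ_j ∇u_j)·n φ - η {ρ}/h (u_i - u_j) φ dσ`, where the
values `gj`, `uj` of the neighbour have already been transported to `S`. -/
def faceForm (η : ℝ) (S : Set (E d)) (n : E d → E d) (ρi ρj ρavg : ℝ)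
    (gi gj : E d → E d) (ui uj φ : E d → ℝ) : ℝ :=
  ∫ x in S, (inner ℝ ((ρi / 2) • gi x + (ρj / 2) • gj x) (n x) * φ x -
    η * ρavg / D.h * (ui x - uj x) * φ x) ∂(surf d)

/-- The bilinear form `B_h`. -/
def Bh (ρ : Fin N → ℝ) (η : ℝ) (u φ : BrokenFun d N) : ℝ :=
  ∑ i, ((∫ x in D.reg i, ρ i * inner ℝ (u.grad i x) (φ.grad i x)) -
      (∫ x in D.outerBdry i, ρ i * inner ℝ (D.trGrad u i x) (outerNormal (D.reg i) x) *
        D.tr φ i x ∂(surf d)) +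
      η * ρ i / D.h * ∫ x in D.outerBdry i, D.tr u i x * D.tr φ i x ∂(surf d)) -
  ∑ e ∈ D.gaps,
    (D.faceForm η (D.gapFaces e).base (outerNormal (D.reg e.1)) (ρ e.1) (ρ e.2) (gapAvgBase ρ e)
        (D.trGrad u e.1) (D.trGrad u e.2 ∘ (D.gapFaces e).toOpp)
        (D.tr u e.1) (D.tr u e.2 ∘ (D.gapFaces e).toOpp) (D.tr φ e.1) +
      D.faceForm η (D.gapFaces e).opp (outerNormal (D.reg e.2)) (ρ e.2) (ρ e.1) (gapAvgOpp ρ e)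
        (D.trGrad u e.2) (D.trGrad u e.1 ∘ (D.gapFaces e).toBase)
        (D.tr u e.2) (D.tr u e.1 ∘ (D.gapFaces e).toBase) (D.tr φ e.2)) -
  ∑ e ∈ D.overlaps,
    (D.faceForm η (D.overlapFaces e).base (outerNormal (D.reg e.1)) (ρ e.1) (ρ e.2)
        (avg ρ e.1 e.2)
        (D.trGrad u e.1) (D.trGrad u e.2 ∘ (D.overlapFaces e).toOpp)
        (D.tr u e.1) (D.tr u e.2 ∘ (D.overlapFaces e).toOpp) (D.tr φ e.1) +
      D.faceForm η (D.overlapFaces e).opp (outerNormal (D.reg e.2)) (ρ e.2) (ρ e.1)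
        (avg ρ e.1 e.2)
        (D.trGrad u e.2) (D.trGrad u e.1 ∘ (D.overlapFaces e).toBase)
        (D.tr u e.2) (D.tr u e.1 ∘ (D.overlapFaces e).toBase) (D.tr φ e.2)) -
  ∑ i, ∑ j ∈ Finset.univ.erase i,
    D.faceForm η (D.matching i j) (interfaceNormal (D.reg i) (D.reg j)) (ρ i) (ρ j) (avg ρ i j)
      (D.trGrad u i) (D.trGrad u j) (D.tr u i) (D.tr u j) (D.tr φ i)

/-- `‖∇f‖` in `L²(∂U)` plus the `L²(U)` norm of the sum of `|D^α f|` over all multi-indices `α`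
of order two. -/
def residualNorm (U : Set (E d)) (f : E d → ℝ) : ℝ≥0∞ :=
  surfSq (frontier U) (trace U (weakGrad U f)) ^ (1 / 2 : ℝ) +
  volSq U (fun x => ∑ k : Fin d, ∑ l ∈ Finset.univ.filter (fun l => k ≤ l),
    |weakPartial U l (weakPartial U k f) x|) ^ (1 / 2 : ℝ)

/-- The quantity `K_{g,o}` for an element `(v, vg)` of `V^*`. On an overlapping region both
`v_i` and `v_j` are taken into account. -/
def Kgo (v : Fin N → E d → ℝ) (vg : Fin N × Fin N → E d → ℝ) : ℝ≥0∞ :=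
  ∑ e ∈ D.gaps, residualNorm (D.gapRegion e) (vg e) +
  ∑ e ∈ D.overlaps, (residualNorm (D.reg e.1 ∩ D.reg e.2) (v e.1) +
    residualNorm (D.reg e.1 ∩ D.reg e.2) (v e.2))

end Decomposition

end NonMatchingDG

end

open NonMatchingDG

noncomputable section

namespace NonMatchingDG

/-! ### Measurability -/

/-! Each volume and face integral in `B_h` is bounded by a weighted Cauchy-Schwarz inequality
(`ofReal_mul_lintegral_mul_le`). With `0 < m ≤ ρ i ≤ R`, fluxes carry the weight `m * h` and
boundary values the weight `m / h`; the powers of `h` cancel and only `R / m`, `η` and `M` remain.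

On gap and overlap faces the dG norm contains the full values on both faces, not only jumps. The
neighbour's contribution therefore only has to be transported to the opposite face. The face map and
the projection back are mutually inverse and Lipschitz with constants `1 + M` and `1`, so the
transport costs at most `(1 + M) ^ (d - 1)` (`setLIntegral_comp_le`, `enorm_faceForm_opposite_le`).
No Taylor expansion across the gap is needed, and the nonnegative term with `Kgo` only enlarges the
right-hand side.

On a matching interface the norm controls only the jump of the test function. The contributions of
the two sides have to be added first: the normals are opposite, so the sum is one integral against
the jump (`enorm_faceForm_add_swap_le`). Combining two Bochner integrals needs integrability of
each, which rests on the finite area of patch boundaries, bounded traces of splines and a measurable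
normal.

The norms take values in `ℝ≥0∞` and may be infinite. -/

theorem stronglyMeasurable_trace {d : ℕ} {F : Type} [NormedAddCommGroup F] [NormedSpace ℝ F]
    [CompleteSpace F] {U : Set (E d)} {f : E d → F}
    (hf : AEStronglyMeasurable f (volume.restrict U)) : StronglyMeasurable (trace U f) := by
  refine StronglyMeasurable.limUnder fun n => ?_
  obtain ⟨g, hg, hfg⟩ := hf
  set r : ℝ := 1 / ((n : ℝ) + 1)
  -- The moving ball is a slice of one measurable set in the product, so both the measure and the
  -- integral in the mean are parametric integrals and depend measurably on the centre.
  let S : Set (E d × E d) := {q | dist q.2 q.1 < r}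
  have hS : MeasurableSet S := measurableSet_lt (by fun_prop) measurable_const
  have key : ∀ x, (⨍ y in Metric.ball x r ∩ U, f y) =
      ((volume.restrict U (Prod.mk x ⁻¹' S)).toReal)⁻¹ •
        ∫ y, S.indicator (fun q => g q.2) (x, y) ∂(volume.restrict U) := by
    intro x
    have hb : Prod.mk x ⁻¹' S = Metric.ball x r := by ext y; simp [S]
    have h1 : ∀ y, S.indicator (fun q => g q.2) (x, y) = (Metric.ball x r).indicator g y := by
      intro y
      by_cases hy : y ∈ Metric.ball x r
      · rw [indicator_of_mem hy, indicator_of_mem]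
        rwa [← hb] at hy
      · rw [indicator_of_notMem hy, indicator_of_notMem]
        rwa [← hb] at hy
    simp_rw [h1]
    rw [setAverage_eq, hb, Measure.restrict_apply Metric.isOpen_ball.measurableSet,
      integral_indicator Metric.isOpen_ball.measurableSet,
      Measure.restrict_restrict Metric.isOpen_ball.measurableSet, Measure.real]
    congr 1
    refine integral_congr_ae (ae_mono (Measure.restrict_mono inter_subset_right le_rfl) hfg)
  simp_rw [key]
  refine StronglyMeasurable.smul ?_ ?_
  · exact ((measurable_measure_prodMk_left hS).ennreal_toReal.inv).stronglyMeasurable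
  · exact StronglyMeasurable.integral_prod_right' (f := S.indicator (fun q => g q.2))
      ((hg.comp_measurable measurable_snd).indicator hS)

theorem measurable_gradient {d : ℕ} (f : E d → ℝ) : Measurable (gradient f) :=
  (InnerProductSpace.toDual ℝ (E d)).symm.continuous.measurable.comp (measurable_fderiv ℝ f)

theorem aestronglyMeasurable_weakPartial {d : ℕ} (U : Set (E d)) (k : Fin d) (f : E d → ℝ) :
    AEStronglyMeasurable (weakPartial U k f) (volume.restrict U) := by
  unfold weakPartial
  split_ifs with h
  · exact h.choose_spec.2.1.aestronglyMeasurable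
  · exact aestronglyMeasurable_zero

theorem aestronglyMeasurable_weakGrad {d : ℕ} (U : Set (E d)) (f : E d → ℝ) :
    AEStronglyMeasurable (weakGrad U f) (volume.restrict U) := by
  have h : AEMeasurable (fun x k => weakPartial U k f x) (volume.restrict U) :=
    aemeasurable_pi_lambda _ fun k => (aestronglyMeasurable_weakPartial U k f).aemeasurable
  exact ((PiLp.continuous_toLp 2 _).measurable.comp_aemeasurable h).aestronglyMeasurable

theorem measurable_bspline (ξ : ℕ → ℝ) (q : ℕ) : ∀ j, Measurable (bspline ξ q j) := by
  induction q with
  | zero => exact fun j => measurable_const.indicator measurableSet_Ico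
  | succ q ih =>
    intro j
    have h1 := ih j
    have h2 := ih (j + 1)
    have : bspline ξ (q + 1) j = fun t =>
        (t - ξ j) / (ξ (j + q + 1) - ξ j) * bspline ξ q j t +
          (ξ (j + q + 2) - t) / (ξ (j + q + 2) - ξ (j + 1)) * bspline ξ q (j + 1) t := rfl
    rw [this]
    fun_prop

theorem measurable_spline {d p : ℕ} (Ξ : Fin d → KnotVector p) (c : BIndex Ξ → ℝ) :
    Measurable (spline Ξ c) := by
  unfold spline tensorBSpline
  refine Finset.measurable_sum _ fun J _ => Measurable.smul_const ?_ _
  refine Finset.measurable_prod _ fun k _ => ?_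
  have := measurable_bspline (Ξ k).knot p (J k)
  fun_prop

theorem measurableSet_openCube (d : ℕ) : MeasurableSet (openCube d) := by
  have : openCube d = ⋂ k, {x : E d | x k ∈ Ioo (0 : ℝ) 1} := by ext; simp [openCube]
  rw [this]
  exact MeasurableSet.iInter fun k => measurableSet_Ioo.preimage (by fun_prop)

theorem openCube_subset_closedCube (d : ℕ) : openCube d ⊆ closedCube d :=
  fun _ hx k => Ioo_subset_Icc_self (hx k)

/-- Lusin-Souslin: injective continuous images of Borel sets are Borel. -/
theorem Patch.measurableSet_image {d p : ℕ} (P : Patch d p) {A : Set (E d)} (hA : MeasurableSet A)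
    (hA' : A ⊆ openCube d) : MeasurableSet (P.param '' A) :=
  have h := hA'.trans (openCube_subset_closedCube d)
  hA.image_of_continuousOn_injOn (P.smooth.continuousOn.mono h) (P.inj.mono h)

theorem Patch.measurableSet_region {d p : ℕ} (P : Patch d p) : MeasurableSet P.region :=
  P.measurableSet_image (measurableSet_openCube d) Subset.rfl

/-- Inside the patch, a preimage under `f` is the image under the parametrization of a preimage
under the spline. Outside, `f` is arbitrary, so only measurability on the patch can hold. -/
theorem Patch.IsSpline.aestronglyMeasurable {d p : ℕ} {P : Patch d p} {f : E d → ℝ}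
    (hf : P.IsSpline f) : AEStronglyMeasurable f (volume.restrict P.region) := by
  obtain ⟨c, hc⟩ := hf
  refine AEMeasurable.aestronglyMeasurable ?_
  refine aemeasurable_restrict_of_measurable_subtype P.measurableSet_region fun A hA => ?_
  have : (fun x : P.region => f x) ⁻¹' A =
      (↑) ⁻¹' (P.param '' (openCube d ∩ spline P.knots c ⁻¹' A)) := by
    ext ⟨y, x, hx, rfl⟩
    simp only [mem_preimage, mem_image, mem_inter_iff, hc x hx]
    refine ⟨fun h => ⟨x, ⟨hx, h⟩, rfl⟩, ?_⟩
    rintro ⟨z, ⟨hz, h⟩, hzx⟩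
    rwa [← hc x hx, ← hzx, hc z hz]
  rw [this]
  exact measurable_subtype_coe (P.measurableSet_image
    ((measurableSet_openCube d).inter (measurable_spline _ c hA)) inter_subset_left)

theorem MemH.aestronglyMeasurable {d m : ℕ} {U : Set (E d)} {f : E d → ℝ} (hf : MemH U m f) :
    AEStronglyMeasurable f (volume.restrict U) := by
  cases m with
  | zero => exact MemLp.aestronglyMeasurable hf
  | succ m => exact hf.1.aestronglyMeasurable

/-! ### Positivity of the mesh size -/

theorem KnotVector.exists_lt {p : ℕ} (Ξ : KnotVector p) :
    ∃ m : Fin (Ξ.n + p), Ξ.knot m < Ξ.knot ((m : ℕ) + 1) := by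
  by_contra! h
  have key : ∀ m, m ≤ Ξ.n + p → Ξ.knot m ≤ 0 := by
    intro m
    induction m with
    | zero => exact fun _ => Ξ.knot_first.le
    | succ m ih => exact fun hm => (h ⟨m, hm⟩).trans (ih (by omega))
  have := key _ le_rfl
  rw [Ξ.knot_last] at this
  linarith

/-- Knots run from 0 to 1, so every direction has a nonempty span; the micro element over such spans
contains two distinct points. -/
theorem meshSize_pos {d p : ℕ} (hd : 0 < d) (Ξ : Fin d → KnotVector p) : 0 < meshSize Ξ := by
  choose m hm using fun k => (Ξ k).exists_lt
  refine lt_of_lt_of_le ?_ (le_ciSup (Set.finite_range _).bddAbove m)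
  set a : Fin d → ℝ := fun k => (Ξ k).knot (m k)
  set b : Fin d → ℝ := fun k => (Ξ k).knot ((m k : ℕ) + 1)
  have hab : ∀ k, a k < b k := hm
  let x : E d := WithLp.toLp 2 fun k => (2 * a k + b k) / 3
  let y : E d := WithLp.toLp 2 fun k => (a k + 2 * b k) / 3
  have hx : x ∈ microElement Ξ m := fun k => by
    have := hab k
    constructor <;> simp only [x] <;> simp only [a, b] at * <;> linarith
  have hy : y ∈ microElement Ξ m := fun k => by
    have := hab k
    constructor <;> simp only [y] <;> simp only [a, b] at * <;> linarith
  have hne : x ≠ y := by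
    intro h
    have h1 := congrArg (fun z : E d => z ⟨0, hd⟩) h
    have := hab ⟨0, hd⟩
    simp only [x, y] at h1
    linarith
  -- Boundedness matters because `Metric.diam` is zero on unbounded sets.
  have hbd : Bornology.IsBounded (microElement Ξ m) := by
    have h1 : Bornology.IsBounded (Set.pi univ fun k => Icc (a k) (b k)) :=
      Bornology.IsBounded.pi fun k => Metric.isBounded_Icc _ _
    have h2 := (PiLp.lipschitzWith_toLp 2 (fun _ : Fin d => ℝ)).isBounded_image h1
    refine h2.subset fun z hz => ⟨z.ofLp, fun k _ => ⟨(hz k).1.le, (hz k).2.le⟩, rfl⟩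
  exact (dist_pos.2 hne).trans_le (Metric.dist_le_diam_of_mem hbd hx hy)

theorem Decomposition.h_pos {d N p : ℕ} (hd : 0 < d) (D : Decomposition d N p) (i : Fin N) :
    0 < D.h :=
  (meshSize_pos hd (D.patch i).knots).trans_le
    (le_ciSup (f := fun i => meshSize (D.patch i).knots) (Set.finite_range _).bddAbove i)

/-! ### Surface integrals and Lipschitz maps -/

theorem surf_image_le {d : ℕ} {K : ℝ≥0} {f : E d → E d} {s : Set (E d)}
    (hf : LipschitzOnWith K f s) : surf d (f '' s) ≤ (K : ℝ≥0∞) ^ (d - 1) * surf d s := by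
  have h := hf.hausdorffMeasure_image_le (d := ((d - 1 : ℕ) : ℝ)) (Nat.cast_nonneg _)
  rw [ENNReal.rpow_natCast] at h
  simp only [surf, Measure.euclideanHausdorffMeasure_def, Measure.smul_apply, ENNReal.smul_def,
    smul_eq_mul]
  rw [mul_left_comm]
  gcongr

/-- A one-sided change of variables without Jacobians: the part of `S` that `f` sends into `A` lies
in `g '' (A ∩ T)`, so the surface measure pushed forward by `f` is at most `K ^ (d - 1)` times that
on `T`. Only the Lipschitz constant of the left inverse enters. -/
theorem setLIntegral_comp_le {d : ℕ} {K : ℝ≥0} {f g : E d → E d} {S T : Set (E d)}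
    (hS : MeasurableSet S) (hf : AEMeasurable f ((surf d).restrict S)) (hfST : MapsTo f S T)
    (hg : LipschitzOnWith K g T) (hgf : ∀ x ∈ S, g (f x) = x) {φ : E d → ℝ≥0∞}
    (hφ : Measurable φ) :
    ∫⁻ x in S, φ (f x) ∂(surf d) ≤ (K : ℝ≥0∞) ^ (d - 1) * ∫⁻ x in T, φ x ∂(surf d) := by
  rw [← lintegral_map' hφ.aemeasurable hf, ← smul_eq_mul, ← lintegral_smul_measure ((K : ℝ≥0∞) ^ (d - 1)) φ]
  refine lintegral_mono' (Measure.le_iff.2 fun A hA => ?_) le_rfl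
  rw [Measure.map_apply_of_aemeasurable hf hA, Measure.restrict_apply' hS, Measure.smul_apply,
    Measure.restrict_apply hA, smul_eq_mul]
  refine le_trans (measure_mono ?_) (surf_image_le (hg.mono (inter_subset_right (s := A))))
  exact fun x hx => ⟨f x, ⟨hx.1, hfST hx.2⟩, hgf x hx.2⟩

namespace OppositeFaces

variable {d : ℕ} (F : OppositeFaces d)

theorem lipschitzWith_toBase : LipschitzWith 1 F.toBase := by
  refine LipschitzWith.of_dist_le_mul fun x y => ?_
  have h1 : inner ℝ F.normal F.normal = (1 : ℝ) := by
    rw [real_inner_self_eq_norm_sq, F.norm_normal]; norm_num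
  have h2 : F.toBase x - F.toBase y = (x - y) - inner ℝ F.normal (x - y) • F.normal := by
    rw [toBase, toBase, inner_sub_right]
    module
  rw [dist_eq_norm, dist_eq_norm, h2, NNReal.coe_one, one_mul]
  refine abs_le_of_sq_le_sq' ?_ (norm_nonneg _) |>.2
  rw [norm_sub_sq_real, inner_smul_right, norm_smul, F.norm_normal, real_inner_comm,
    Real.norm_eq_abs, mul_one, sq_abs]
  nlinarith [sq_nonneg (inner ℝ F.normal (x - y))]

theorem lipschitzOnWith_toOpp {M : ℝ≥0} (hM : LipschitzOnWith M F.height F.base) :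
    LipschitzOnWith (1 + M) F.toOpp F.base := by
  refine LipschitzOnWith.of_dist_le_mul fun x hx y hy => ?_
  have h := hM.dist_le_mul x hx y hy
  have h2 : F.toOpp x - F.toOpp y = (x - y) + (F.height x - F.height y) • F.normal := by
    rw [toOpp, toOpp]
    module
  rw [dist_eq_norm, h2]
  refine (norm_add_le _ _).trans ?_
  rw [norm_smul, F.norm_normal, mul_one, ← dist_eq_norm, ← dist_eq_norm, NNReal.coe_add,
    NNReal.coe_one]
  linarith

theorem mapsTo_toBase : MapsTo F.toBase F.opp F.base := by
  rintro _ ⟨x, hx, rfl⟩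
  rwa [F.toBase_toOpp hx]

theorem toOpp_toBase {y : E d} (hy : y ∈ F.opp) : F.toOpp (F.toBase y) = y := by
  obtain ⟨x, hx, rfl⟩ := hy
  rw [F.toBase_toOpp hx]

end OppositeFaces

/-! ### Weighted Cauchy-Schwarz inequalities -/

/-- Cauchy-Schwarz bounds the left side by `c` times the root of `(L / a) X` times the root of `Y /
b`; `hcK` compares this constant with `K` under the root. `L` leaves room for the cost of transport
between faces. -/
theorem ofReal_mul_lintegral_mul_le {α : Type*} [MeasurableSpace α] {μ : Measure α}
    {f g : α → ℝ≥0∞} (hf : AEMeasurable f μ) (hg : AEMeasurable g μ) {a b c K L : ℝ}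
    (ha : 0 < a) (hb : 0 < b) (hc : 0 ≤ c) (hK : 0 ≤ K) (hL : 0 ≤ L)
    (hcK : c ^ 2 * L ≤ K ^ 2 * (a * b)) {X Y : ℝ≥0∞}
    (hX : ENNReal.ofReal a * ∫⁻ x, f x ^ 2 ∂μ ≤ ENNReal.ofReal L * X)
    (hY : ENNReal.ofReal b * ∫⁻ x, g x ^ 2 ∂μ ≤ Y) :
    ENNReal.ofReal c * ∫⁻ x, f x * g x ∂μ ≤
      ENNReal.ofReal K * (X ^ (1 / 2 : ℝ) * Y ^ (1 / 2 : ℝ)) := by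
  have hhalf : (0 : ℝ) ≤ 1 / 2 := by norm_num
  have hsq : ∀ t : ℝ, 0 ≤ t → ENNReal.ofReal t = ENNReal.ofReal (t ^ 2) ^ (1 / 2 : ℝ) := by
    intro t ht
    rw [ENNReal.ofReal_rpow_of_nonneg (by positivity) hhalf, ← Real.sqrt_eq_rpow, Real.sqrt_sq ht]
  have hX' : ∫⁻ x, f x ^ 2 ∂μ ≤ ENNReal.ofReal (L / a) * X := by
    rw [ENNReal.ofReal_div_of_pos ha, div_eq_mul_inv, mul_right_comm, ← div_eq_mul_inv,
      ENNReal.le_div_iff_mul_le (by simp [ha]) (by simp), mul_comm]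
    exact hX
  have hY' : ∫⁻ x, g x ^ 2 ∂μ ≤ ENNReal.ofReal (1 / b) * Y := by
    rw [ENNReal.ofReal_div_of_pos hb, ENNReal.ofReal_one, div_eq_mul_inv, one_mul, mul_comm,
      ← div_eq_mul_inv, ENNReal.le_div_iff_mul_le (by simp [hb]) (by simp), mul_comm]
    exact hY
  have hCS := ENNReal.lintegral_mul_le_Lp_mul_Lq μ Real.HolderConjugate.two_two hf hg
  simp only [Pi.mul_apply, ENNReal.rpow_two] at hCS
  calc ENNReal.ofReal c * ∫⁻ x, f x * g x ∂μ
      ≤ ENNReal.ofReal (c ^ 2) ^ (1 / 2 : ℝ) * ((ENNReal.ofReal (L / a) * X) ^ (1 / 2 : ℝ) *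
          (ENNReal.ofReal (1 / b) * Y) ^ (1 / 2 : ℝ)) := by
        rw [hsq c hc]
        gcongr
        exact hCS.trans (by gcongr)
    _ = ENNReal.ofReal (c ^ 2 * (L / a * (1 / b))) ^ (1 / 2 : ℝ) *
          (X ^ (1 / 2 : ℝ) * Y ^ (1 / 2 : ℝ)) := by
        rw [ENNReal.ofReal_mul (by positivity), ENNReal.ofReal_mul (by positivity)]
        simp only [ENNReal.mul_rpow_of_nonneg _ _ hhalf]
        ring
    _ ≤ _ := by
        rw [hsq K hK]
        gcongr
        have : c ^ 2 * (L / a * (1 / b)) = c ^ 2 * L / (a * b) := by field_simp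
        rw [this, div_le_iff₀ (by positivity)]
        exact hcK

theorem surfSq_sub_le {d : ℕ} {S : Set (E d)} {f g : E d → ℝ}
    (hf : AEMeasurable f ((surf d).restrict S)) :
    surfSq S (fun x => f x - g x) ≤ 2 * surfSq S f + 2 * surfSq S g := by
  unfold surfSq
  rw [← lintegral_const_mul' _ _ (by simp), ← lintegral_const_mul' _ _ (by simp),
    ← lintegral_add_left' (by fun_prop)]
  refine lintegral_mono fun x => ?_
  simp only [← ofReal_norm, ← ENNReal.ofReal_pow (norm_nonneg _)]
  have h2 : (2 : ℝ≥0∞) = ENNReal.ofReal 2 := by simp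
  rw [h2, ← ENNReal.ofReal_mul (by norm_num), ← ENNReal.ofReal_mul (by norm_num),
    ← ENNReal.ofReal_add (by positivity) (by positivity)]
  refine ENNReal.ofReal_le_ofReal ?_
  simp only [Real.norm_eq_abs, sq_abs]
  nlinarith [sq_nonneg (f x + g x)]

theorem surfSq_mono {d : ℕ} {F : Type} [NormedAddCommGroup F] {S T : Set (E d)} (h : S ⊆ T)
    (f : E d → F) : surfSq S f ≤ surfSq T f :=
  lintegral_mono_set h

/-! ### Face integrals over gap and overlap faces -/

namespace Decomposition

variable {d N p : ℕ} (D : Decomposition d N p)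

/-- Cauchy-Schwarz for each of three terms: the two fluxes give `R / (2 * m) * L` each and the
penalty gives `2 * η * R / m * L`. The bound `L ≤ L ^ 2` trades the root of `L` for `L`. -/
theorem enorm_faceForm_le {η m R L : ℝ} (hη : 0 ≤ η) (hm : 0 < m) (hL : 1 ≤ L) (hh : 0 < D.h)
    {S : Set (E d)} {n : E d → E d} (hn : ∀ x, ‖n x‖ ≤ 1) {ρi ρj ρavg : ℝ}
    (hi : 0 ≤ ρi ∧ ρi ≤ R) (hj : 0 ≤ ρj ∧ ρj ≤ R) (ha : 0 ≤ ρavg ∧ ρavg ≤ R)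
    {gi gj : E d → E d} {ui uj φ : E d → ℝ}
    (mgi : AEMeasurable gi ((surf d).restrict S)) (mgj : AEMeasurable gj ((surf d).restrict S))
    (mui : AEMeasurable ui ((surf d).restrict S)) (muj : AEMeasurable uj ((surf d).restrict S))
    (mφ : AEMeasurable φ ((surf d).restrict S)) {X Y : ℝ≥0∞}
    (hgi : ENNReal.ofReal (m * D.h) * surfSq S gi ≤ ENNReal.ofReal L * X)
    (hgj : ENNReal.ofReal (m * D.h) * surfSq S gj ≤ ENNReal.ofReal L * X)
    (hu : ENNReal.ofReal (m / D.h) * surfSq S (fun x => ui x - uj x) ≤ ENNReal.ofReal (4 * L) * X)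
    (hφ : ENNReal.ofReal (m / D.h) * surfSq S φ ≤ Y) :
    ‖D.faceForm η S n ρi ρj ρavg gi gj ui uj φ‖ₑ ≤
      ENNReal.ofReal (R / m * (1 + 2 * η) * L) * (X ^ (1 / 2 : ℝ) * Y ^ (1 / 2 : ℝ)) := by
  have hR : 0 ≤ R := hi.1.trans hi.2
  have hLL : L ≤ L ^ 2 := by nlinarith
  have hab : m * D.h * (m / D.h) = m ^ 2 := by field_simp
  have hab' : m / D.h * (m / D.h) = m ^ 2 / D.h ^ 2 := by field_simp
  have e1 := ofReal_mul_lintegral_mul_le (mgi.enorm) (mφ.enorm) (c := R / 2) (K := R / m / 2 * L)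
    (by positivity) (by positivity) (by positivity) (by positivity) (by positivity)
    (by rw [hab]
        have : (R / m / 2 * L) ^ 2 * m ^ 2 = (R / 2) ^ 2 * L ^ 2 := by field_simp
        rw [this]; gcongr) hgi hφ
  have e2 := ofReal_mul_lintegral_mul_le (mgj.enorm) (mφ.enorm) (c := R / 2) (K := R / m / 2 * L)
    (by positivity) (by positivity) (by positivity) (by positivity) (by positivity)
    (by rw [hab]
        have : (R / m / 2 * L) ^ 2 * m ^ 2 = (R / 2) ^ 2 * L ^ 2 := by field_simp
        rw [this]; gcongr) hgj hφ
  have e3 := ofReal_mul_lintegral_mul_le ((mui.sub muj).enorm) (mφ.enorm) (c := η * R / D.h)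
    (K := R / m * (2 * η) * L)
    (by positivity) (by positivity) (by positivity) (by positivity) (by positivity)
    (by rw [hab']
        have : (R / m * (2 * η) * L) ^ 2 * (m ^ 2 / D.h ^ 2) =
          (η * R / D.h) ^ 2 * (4 * L ^ 2) := by field_simp; ring
        rw [this]; gcongr) hu hφ
  have hpt : ∀ x, ‖inner ℝ ((ρi / 2) • gi x + (ρj / 2) • gj x) (n x) * φ x -
      η * ρavg / D.h * (ui x - uj x) * φ x‖ₑ ≤
      ENNReal.ofReal (R / 2) * (‖gi x‖ₑ * ‖φ x‖ₑ) + ENNReal.ofReal (R / 2) * (‖gj x‖ₑ * ‖φ x‖ₑ) +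
        ENNReal.ofReal (η * R / D.h) * (‖ui x - uj x‖ₑ * ‖φ x‖ₑ) := by
    intro x
    simp only [← ofReal_norm, ← ENNReal.ofReal_mul (norm_nonneg _)]
    rw [← ENNReal.ofReal_mul (by positivity), ← ENNReal.ofReal_mul (by positivity),
      ← ENNReal.ofReal_mul (by positivity), ← ENNReal.ofReal_add (by positivity) (by positivity),
      ← ENNReal.ofReal_add (by positivity) (by positivity)]
    refine ENNReal.ofReal_le_ofReal ?_
    have f1 : ‖inner ℝ ((ρi / 2) • gi x + (ρj / 2) • gj x) (n x)‖ ≤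
        R / 2 * ‖gi x‖ + R / 2 * ‖gj x‖ := by
      refine (norm_inner_le_norm _ _).trans ((mul_le_of_le_one_right (norm_nonneg _) (hn x)).trans
        ((norm_add_le _ _).trans ?_))
      rw [norm_smul, norm_smul, Real.norm_of_nonneg (by linarith), Real.norm_of_nonneg (by linarith)]
      gcongr
      · exact hi.2
      · exact hj.2
    have f2 : ‖η * ρavg / D.h * (ui x - uj x)‖ ≤ η * R / D.h * ‖ui x - uj x‖ := by
      have := ha.1
      rw [norm_mul, Real.norm_of_nonneg (by positivity)]
      gcongr
      exact ha.2
    refine (norm_sub_le _ _).trans ?_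
    rw [norm_mul, norm_mul _ (φ x)]
    have := mul_le_mul_of_nonneg_right f1 (norm_nonneg (φ x))
    have := mul_le_mul_of_nonneg_right f2 (norm_nonneg (φ x))
    linarith
  refine (enorm_integral_le_lintegral_enorm _).trans ((lintegral_mono hpt).trans ?_)
  rw [lintegral_add_left' (by fun_prop), lintegral_add_left' (by fun_prop),
    lintegral_const_mul' _ _ (by simp), lintegral_const_mul' _ _ (by simp),
    lintegral_const_mul' _ _ (by simp)]
  refine (add_le_add (add_le_add e1 e2) e3).trans (le_of_eq ?_)
  rw [← add_mul, ← add_mul, ← ENNReal.ofReal_add (by positivity) (by positivity),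
    ← ENNReal.ofReal_add (by positivity) (by positivity)]
  congr 2
  ring

/-- The hypotheses bound each component on its own face; the transported component is reduced to
this by a change of variables. This is the only place where the slope bound affects the constant,
and no cancellation between the faces is used. -/
theorem enorm_faceForm_opposite_le {η m R : ℝ} {M : ℝ≥0} (hη : 0 ≤ η) (hm : 0 < m) (hh : 0 < D.h)
    (F : OppositeFaces d) (hb : MeasurableSet F.base) (ho : MeasurableSet F.opp)
    (hM : LipschitzOnWith M F.height F.base)
    {n₁ n₂ : E d → E d} (hn₁ : ∀ x, ‖n₁ x‖ ≤ 1) (hn₂ : ∀ x, ‖n₂ x‖ ≤ 1) {ρi ρj a₁ a₂ : ℝ}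
    (hi : 0 ≤ ρi ∧ ρi ≤ R) (hj : 0 ≤ ρj ∧ ρj ≤ R) (ha₁ : 0 ≤ a₁ ∧ a₁ ≤ R) (ha₂ : 0 ≤ a₂ ∧ a₂ ≤ R)
    {gi gj : E d → E d} {ui uj φi φj : E d → ℝ} (mgi : Measurable gi) (mgj : Measurable gj)
    (mui : Measurable ui) (muj : Measurable uj) (mφi : Measurable φi) (mφj : Measurable φj)
    {X Y : ℝ≥0∞}
    (hgi : ENNReal.ofReal (m * D.h) * surfSq F.base gi ≤ X)
    (hgj : ENNReal.ofReal (m * D.h) * surfSq F.opp gj ≤ X)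
    (hui : ENNReal.ofReal (m / D.h) * surfSq F.base ui ≤ X)
    (huj : ENNReal.ofReal (m / D.h) * surfSq F.opp uj ≤ X)
    (hφi : ENNReal.ofReal (m / D.h) * surfSq F.base φi ≤ Y)
    (hφj : ENNReal.ofReal (m / D.h) * surfSq F.opp φj ≤ Y) :
    ‖D.faceForm η F.base n₁ ρi ρj a₁ gi (gj ∘ F.toOpp) ui (uj ∘ F.toOpp) φi +
      D.faceForm η F.opp n₂ ρj ρi a₂ gj (gi ∘ F.toBase) uj (ui ∘ F.toBase) φj‖ₑ ≤
      2 * (ENNReal.ofReal (R / m * (1 + 2 * η) * (1 + M) ^ (d - 1)) *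
        (X ^ (1 / 2 : ℝ) * Y ^ (1 / 2 : ℝ))) := by
  set L : ℝ := (1 + M) ^ (d - 1) with hLdef
  have hL : 1 ≤ L := one_le_pow₀ (by simp)
  have hL' : ENNReal.ofReal L = ((1 + M : ℝ≥0) : ℝ≥0∞) ^ (d - 1) := by
    rw [hLdef, ENNReal.ofReal_pow (by positivity)]
    congr 1
    rw [← ENNReal.ofReal_coe_nnreal, NNReal.coe_add, NNReal.coe_one]
  have hL1 : 1 ≤ ENNReal.ofReal L := by simpa using hL
  have mO : AEMeasurable F.toOpp ((surf d).restrict F.base) :=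
    (F.lipschitzOnWith_toOpp hM).continuousOn.aemeasurable hb
  have mB : AEMeasurable F.toBase ((surf d).restrict F.opp) :=
    F.lipschitzWith_toBase.continuous.measurable.aemeasurable
  -- The inverse of `toOpp` is the projection `toBase`, so this direction costs a factor 1, enlarged
  -- to `L` for symmetry; in `tB` the inverse is `toOpp`, which costs the full `L`.
  have tO : ∀ {G : Type} [NormedAddCommGroup G] [MeasurableSpace G] [BorelSpace G] {f : E d → G},
      Measurable f → surfSq F.base (f ∘ F.toOpp) ≤ ENNReal.ofReal L * surfSq F.opp f := by
    intro G _ _ _ f hf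
    refine (setLIntegral_comp_le (φ := fun x => ‖f x‖ₑ ^ 2) hb mO (mapsTo_image _ _)
      F.lipschitzWith_toBase.lipschitzOnWith (fun x hx => F.toBase_toOpp hx)
      (by fun_prop)).trans ?_
    simp only [ENNReal.coe_one, one_pow]
    exact mul_le_mul_left hL1 _
  have tB : ∀ {G : Type} [NormedAddCommGroup G] [MeasurableSpace G] [BorelSpace G] {f : E d → G},
      Measurable f → surfSq F.opp (f ∘ F.toBase) ≤ ENNReal.ofReal L * surfSq F.base f := by
    intro G _ _ _ f hf
    rw [hL']
    exact setLIntegral_comp_le (φ := fun x => ‖f x‖ₑ ^ 2) ho mB F.mapsTo_toBase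
      (F.lipschitzOnWith_toOpp hM) (fun x hx => F.toOpp_toBase hx) (by fun_prop)
  have up : ∀ {A : ℝ≥0∞}, A ≤ X → A ≤ ENNReal.ofReal L * X := fun h =>
    h.trans (le_mul_of_one_le_left' hL1)
  have tr : ∀ {A B : ℝ≥0∞} {a : ℝ}, A ≤ ENNReal.ofReal L * B → ENNReal.ofReal a * B ≤ X →
      ENNReal.ofReal a * A ≤ ENNReal.ofReal L * X := by
    intro A B a h1 h2
    calc _ ≤ ENNReal.ofReal a * (ENNReal.ofReal L * B) := by gcongr
      _ = ENNReal.ofReal L * (ENNReal.ofReal a * B) := by ring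
      _ ≤ _ := by gcongr
  have df : ∀ {S : Set (E d)} {f g : E d → ℝ}, AEMeasurable f ((surf d).restrict S) →
      ENNReal.ofReal (m / D.h) * surfSq S f ≤ ENNReal.ofReal L * X →
      ENNReal.ofReal (m / D.h) * surfSq S g ≤ ENNReal.ofReal L * X →
      ENNReal.ofReal (m / D.h) * surfSq S (fun x => f x - g x) ≤ ENNReal.ofReal (4 * L) * X := by
    intro S f g mf hf hg
    calc _ ≤ ENNReal.ofReal (m / D.h) * (2 * surfSq S f + 2 * surfSq S g) := by
            gcongr; exact surfSq_sub_le mf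
      _ = 2 * (ENNReal.ofReal (m / D.h) * surfSq S f) +
            2 * (ENNReal.ofReal (m / D.h) * surfSq S g) := by ring
      _ ≤ 2 * (ENNReal.ofReal L * X) + 2 * (ENNReal.ofReal L * X) := by gcongr
      _ = _ := by
        rw [ENNReal.ofReal_mul (by norm_num), ENNReal.ofReal_ofNat]; ring
  rw [two_mul]
  refine (enorm_add_le _ _).trans (add_le_add ?_ ?_)
  · exact D.enorm_faceForm_le hη hm hL hh hn₁ hi hj ha₁ mgi.aemeasurable
      (mgj.comp_aemeasurable mO) mui.aemeasurable (muj.comp_aemeasurable mO) mφi.aemeasurable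
      (up hgi) (tr (tO mgj) hgj) (df mui.aemeasurable (up hui) (tr (tO muj) huj)) hφi
  · exact D.enorm_faceForm_le hη hm hL hh hn₂ hj hi ha₂ mgj.aemeasurable
      (mgi.comp_aemeasurable mB) muj.aemeasurable (mui.comp_aemeasurable mB) mφj.aemeasurable
      (up hgj) (tr (tB mgi) hgi) (df muj.aemeasurable (up huj) (tr (tB mui) hui)) hφj

end Decomposition

/-- The estimates only use that normals have length at most one, so the default value zero is
harmless. -/
theorem norm_outerNormal_le {d : ℕ} (U : Set (E d)) (x : E d) : ‖outerNormal U x‖ ≤ 1 := by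
  unfold outerNormal
  split_ifs with h
  · exact h.choose_spec.1.le
  · simp

theorem norm_interfaceNormal_le {d : ℕ} (U V : Set (E d)) (x : E d) :
    ‖interfaceNormal U V x‖ ≤ 1 := by
  unfold interfaceNormal
  split_ifs with h
  · exact h.choose_spec.1.1.le
  · simp

/-- The components of a patchwise function and of its gradient are measurable on the patches. -/
structure Decomposition.AEMeas {d N p : ℕ} (D : Decomposition d N p) (u : BrokenFun d N) :
    Prop where
  val : ∀ i, AEStronglyMeasurable (u.val i) (volume.restrict (D.reg i))
  grad : ∀ i, AEStronglyMeasurable (u.grad i) (volume.restrict (D.reg i))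

/-! ### Measurability of boundary values -/

namespace Decomposition

variable {d N p : ℕ} (D : Decomposition d N p)

section

variable {D}

theorem AEMeas.measurable_tr {u : BrokenFun d N} (hu : D.AEMeas u) (i : Fin N) :
    Measurable (D.tr u i) :=
  (stronglyMeasurable_trace (hu.val i)).measurable

theorem AEMeas.measurable_trGrad {u : BrokenFun d N} (hu : D.AEMeas u) (i : Fin N) :
    Measurable (D.trGrad u i) :=
  (stronglyMeasurable_trace (hu.grad i)).measurable

theorem MemVh.aemeas {φ : Fin N → E d → ℝ} (hφ : D.MemVh φ) : D.AEMeas (BrokenFun.ofSpline φ) where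
  val i := (hφ i).aestronglyMeasurable
  grad i := (measurable_gradient (φ i)).aestronglyMeasurable

theorem MemVstar.aemeas_sum {ℓ : ℕ} {v w : Fin N → E d → ℝ} {vg : Fin N × Fin N → E d → ℝ}
    (hv : D.MemVstar ℓ v vg) (hw : D.MemVh w) : D.AEMeas (D.sum v w) where
  val i := (hv.sobolev i).aestronglyMeasurable.add (hw i).aestronglyMeasurable
  grad i := (aestronglyMeasurable_weakGrad _ _).add (measurable_gradient (w i)).aestronglyMeasurable

end

/-! ### Components of the dG norm -/

section

variable {ρ : Fin N → ℝ} (u : BrokenFun d N)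

theorem volSq_le_dGSq (i : Fin N) :
    ENNReal.ofReal (ρ i) * volSq (D.reg i) (u.grad i) ≤ D.dGSq ρ u := by
  unfold dGSq
  refine le_add_right (le_add_right (le_add_right (le_trans ?_
    (Finset.single_le_sum (fun _ _ => zero_le) (Finset.mem_univ i)))))
  exact le_self_add

theorem outerBdry_le_dGSq (i : Fin N) :
    ENNReal.ofReal (ρ i / D.h) * surfSq (D.outerBdry i) (D.tr u i) ≤ D.dGSq ρ u := by
  unfold dGSq
  refine le_add_right (le_add_right (le_add_right (le_trans ?_
    (Finset.single_le_sum (fun _ _ => zero_le) (Finset.mem_univ i)))))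
  exact le_add_self

theorem gap_le_dGSq {e : Fin N × Fin N} (he : e ∈ D.gaps) :
    ENNReal.ofReal (gapAvgBase ρ e / D.h) * surfSq (D.gapFaces e).base (D.tr u e.1) +
      ENNReal.ofReal (gapAvgOpp ρ e / D.h) * surfSq (D.gapFaces e).opp (D.tr u e.2) ≤
      D.dGSq ρ u := by
  unfold dGSq
  exact le_add_right (le_add_right (le_add_left
    (Finset.single_le_sum (f := fun e => ENNReal.ofReal (gapAvgBase ρ e / D.h) *
      surfSq (D.gapFaces e).base (D.tr u e.1) + ENNReal.ofReal (gapAvgOpp ρ e / D.h) *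
      surfSq (D.gapFaces e).opp (D.tr u e.2)) (fun _ _ => zero_le) he)))

theorem overlap_le_dGSq {e : Fin N × Fin N} (he : e ∈ D.overlaps) :
    ENNReal.ofReal (avg ρ e.1 e.2 / D.h) * surfSq (D.overlapFaces e).base (D.tr u e.1) +
      ENNReal.ofReal (avg ρ e.1 e.2 / D.h) * surfSq (D.overlapFaces e).opp (D.tr u e.2) ≤
      D.dGSq ρ u := by
  unfold dGSq
  exact le_add_right (le_add_left
    (Finset.single_le_sum (f := fun e => ENNReal.ofReal (avg ρ e.1 e.2 / D.h) *
      surfSq (D.overlapFaces e).base (D.tr u e.1) + ENNReal.ofReal (avg ρ e.1 e.2 / D.h) *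
      surfSq (D.overlapFaces e).opp (D.tr u e.2)) (fun _ _ => zero_le) he))

end

end Decomposition

/-! ### Measurability of the interface normal -/

/-- If `n ≠ n'`, a small step from `x` in the direction `n' - n` must end in `U` according to `n`
and outside of `U` according to `n'`. -/
theorem IsOuterUnitNormal.unique {d : ℕ} {U : Set (E d)} {x n n' : E d}
    (h : IsOuterUnitNormal U x n) (h' : IsOuterUnitNormal U x n') : n = n' := by
  by_contra hne
  have h1 : inner ℝ n n' < 1 := inner_lt_one_iff_real_of_norm_eq_one h.1 h'.1 |>.2 hne
  set v := n' - n
  have hv : 0 < ‖v‖ := norm_pos_iff.2 (sub_ne_zero.2 (Ne.symm hne))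
  have e1 : inner ℝ n v = inner ℝ n n' - 1 := by
    rw [inner_sub_right, real_inner_self_eq_norm_sq, h.1]; norm_num
  have e2 : inner ℝ n' v = 1 - inner ℝ n n' := by
    rw [inner_sub_right, real_inner_self_eq_norm_sq, h'.1, real_inner_comm]; norm_num
  -- Chosen so that `ε * ‖v‖` is half of the value `1 - ⟪n, n'⟫` of both `⟪n', v⟫` and `-⟪n, v⟫`,
  -- which puts the step strictly inside both cones.
  set ε := (1 - inner ℝ n n') / (2 * ‖v‖) with hεdef
  have hε : 0 < ε := div_pos (by linarith) (by positivity)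
  have hεv : ε * ‖v‖ = (1 - inner ℝ n n') / 2 := by rw [hεdef]; field_simp
  have hc : Tendsto (fun t : ℝ => x + t • v) (𝓝[>] 0) (𝓝 x) := by
    have : Continuous fun t : ℝ => x + t • v := by fun_prop
    have h0 := this.tendsto 0
    rw [zero_smul, add_zero] at h0
    exact h0.mono_left nhdsWithin_le_nhds
  obtain ⟨t, ⟨h2, h3⟩, ht⟩ := (((hc.eventually (h.2 ε hε)).and (hc.eventually (h'.2 ε hε))).and
    self_mem_nhdsWithin).exists
  have ht : 0 < t := ht
  have e3 : ε * ‖x + t • v - x‖ = t * ((1 - inner ℝ n n') / 2) := by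
    rw [add_sub_cancel_left, norm_smul, Real.norm_of_nonneg ht.le, ← hεv]; ring
  refine h3.2 ?_ (h2.1 ?_)
  · rw [e3, add_sub_cancel_left, inner_smul_right, e2]
    nlinarith
  · rw [neg_mul, e3, add_sub_cancel_left, inner_smul_right, e1]
    nlinarith

/-- For fixed aperture and radius the condition is closed in the pair (point, normal), for an
arbitrary `U`: its failure is a union over witnesses `y` of open conditions. Apertures and radii of
the form `1 / (k + 1)` suffice. -/
theorem measurableSet_isOuterUnitNormal {d : ℕ} (U : Set (E d)) :
    MeasurableSet {q : E d × E d | IsOuterUnitNormal U q.1 q.2} := by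
  let A : ℕ → ℕ → Set (E d × E d) := fun a b => {q | ∀ y ∈ Metric.ball q.1 (1 / ((b : ℝ) + 1)),
    (inner ℝ q.2 (y - q.1) < -(1 / ((a : ℝ) + 1)) * ‖y - q.1‖ → y ∈ U) ∧
      (1 / ((a : ℝ) + 1) * ‖y - q.1‖ < inner ℝ q.2 (y - q.1) → y ∉ U)}
  have hA : ∀ a b, IsClosed (A a b) := by
    intro a b
    rw [← isOpen_compl_iff]
    have : (A a b)ᶜ = (⋃ y ∈ Uᶜ, {q : E d × E d | dist y q.1 < 1 / ((b : ℝ) + 1)} ∩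
          {q | inner ℝ q.2 (y - q.1) < -(1 / ((a : ℝ) + 1)) * ‖y - q.1‖}) ∪
        ⋃ y ∈ U, {q : E d × E d | dist y q.1 < 1 / ((b : ℝ) + 1)} ∩
          {q | 1 / ((a : ℝ) + 1) * ‖y - q.1‖ < inner ℝ q.2 (y - q.1)} := by
      ext q
      simp only [A, mem_compl_iff, mem_ofPred_eq, mem_union, mem_iUnion, mem_inter_iff,
        Metric.mem_ball, not_forall, exists_prop]
      constructor
      · rintro ⟨y, hy, h⟩
        by_cases hyU : y ∈ U
        · exact Or.inr ⟨y, hyU, hy, by tauto⟩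
        · exact Or.inl ⟨y, hyU, hy, by tauto⟩
      · rintro (⟨y, hyU, hy, h⟩ | ⟨y, hyU, hy, h⟩) <;> exact ⟨y, hy, by tauto⟩
    rw [this]
    refine IsOpen.union ?_ ?_ <;>
      exact isOpen_biUnion fun y _ => (isOpen_lt (by fun_prop) (by fun_prop)).inter
        (isOpen_lt (by fun_prop) (by fun_prop))
  have key : {q : E d × E d | IsOuterUnitNormal U q.1 q.2} =
      {q | ‖q.2‖ = 1} ∩ ⋂ a, ⋃ b, A a b := by
    ext q
    simp only [mem_ofPred_eq, mem_inter_iff, mem_iInter, mem_iUnion, IsOuterUnitNormal]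
    refine and_congr_right fun _ => ⟨fun h a => ?_, fun h ε hε => ?_⟩
    · obtain ⟨δ, hδ, hball⟩ := Metric.eventually_nhds_iff_ball.1
        (h (1 / ((a : ℝ) + 1)) (by positivity))
      obtain ⟨b, hb⟩ := exists_nat_one_div_lt hδ
      exact ⟨b, fun y hy => hball y (Metric.ball_subset_ball hb.le hy)⟩
    · obtain ⟨a, ha⟩ := exists_nat_one_div_lt hε
      obtain ⟨b, hb⟩ := h a
      refine Metric.eventually_nhds_iff_ball.2 ⟨1 / ((b : ℝ) + 1), by positivity, fun y hy => ?_⟩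
      have h1 : 1 / ((a : ℝ) + 1) * ‖y - q.1‖ ≤ ε * ‖y - q.1‖ := by gcongr
      refine ⟨fun h => (hb y hy).1 (h.trans_le ?_), fun h => (hb y hy).2 (h1.trans_lt h)⟩
      rw [neg_mul, neg_mul]
      exact neg_le_neg h1
  rw [key]
  exact (measurableSet_eq_fun (by fun_prop) measurable_const).inter
    (MeasurableSet.iInter fun a => MeasurableSet.iUnion fun b => (hA a b).measurableSet)

theorem interfaceNormal_eq {d : ℕ} {U V : Set (E d)} {x n : E d} (h : IsOuterUnitNormal U x n)
    (h' : IsOuterUnitNormal V x (-n)) : interfaceNormal U V x = n := by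
  have hex : ∃ n, IsOuterUnitNormal U x n ∧ IsOuterUnitNormal V x (-n) := ⟨n, h, h'⟩
  rw [interfaceNormal, dif_pos hex]
  exact hex.choose_spec.1.unique h

/-- Uniqueness makes the two choices agree up to sign; where no normal exists, both are zero. The
cancellation on matching interfaces depends on this identity at every point. -/
theorem interfaceNormal_swap {d : ℕ} (U V : Set (E d)) (x : E d) :
    interfaceNormal V U x = -interfaceNormal U V x := by
  by_cases h : ∃ n, IsOuterUnitNormal U x n ∧ IsOuterUnitNormal V x (-n)
  · obtain ⟨n, h1, h2⟩ := h
    rw [interfaceNormal_eq h1 h2, interfaceNormal_eq h2 (by rwa [neg_neg])]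
  · have h' : ¬∃ n, IsOuterUnitNormal V x n ∧ IsOuterUnitNormal U x (-n) := by
      rintro ⟨n, h1, h2⟩
      exact h ⟨-n, h2, by rwa [neg_neg]⟩
    rw [interfaceNormal, interfaceNormal, dif_neg h, dif_neg h', neg_zero]

/-- The graph of the normal is Borel and, by uniqueness, projects injectively to the points, so the
projection of a Borel part is Borel (Lusin-Souslin). Points without a normal are added when the
default zero lies in `A`. -/
theorem measurable_interfaceNormal {d : ℕ} (U V : Set (E d)) :
    Measurable (interfaceNormal U V) := by
  let G : Set (E d × E d) := {q | IsOuterUnitNormal U q.1 q.2} ∩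
    (fun q => (q.1, -q.2)) ⁻¹' {q | IsOuterUnitNormal V q.1 q.2}
  have hG : MeasurableSet G := (measurableSet_isOuterUnitNormal U).inter
    ((measurableSet_isOuterUnitNormal V).preimage (by fun_prop))
  have hinj : ∀ A : Set (E d), MeasurableSet A → MeasurableSet (Prod.fst '' (G ∩ Prod.snd ⁻¹' A)) := by
    intro A hA
    refine (hG.inter (measurable_snd hA)).image_of_measurable_injOn measurable_fst ?_
    rintro ⟨x, n⟩ ⟨⟨h1, -⟩, -⟩ ⟨y, n'⟩ ⟨⟨h2, -⟩, -⟩ rfl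
    exact Prod.ext rfl (h1.unique h2)
  intro A hA
  have : interfaceNormal U V ⁻¹' A = Prod.fst '' (G ∩ Prod.snd ⁻¹' A) ∪
      ((Prod.fst '' (G ∩ Prod.snd ⁻¹' univ))ᶜ ∩ {_x | (0 : E d) ∈ A}) := by
    ext x
    by_cases h : ∃ n, IsOuterUnitNormal U x n ∧ IsOuterUnitNormal V x (-n)
    · obtain ⟨n, h1, h2⟩ := h
      have hx : x ∈ Prod.fst '' (G ∩ Prod.snd ⁻¹' univ) := ⟨(x, n), ⟨⟨h1, h2⟩, trivial⟩, rfl⟩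
      simp only [mem_preimage, interfaceNormal_eq h1 h2, mem_union, mem_inter_iff, mem_compl_iff,
        hx, not_true_eq_false, false_and, or_false]
      refine ⟨fun h => ⟨(x, n), ⟨⟨h1, h2⟩, h⟩, rfl⟩, ?_⟩
      rintro ⟨⟨y, n'⟩, ⟨⟨h3, -⟩, h4⟩, rfl⟩
      rwa [h1.unique h3]
    · have hx : ∀ B, x ∉ Prod.fst '' (G ∩ Prod.snd ⁻¹' B) := by
        rintro B ⟨⟨y, n⟩, ⟨⟨h1, h2⟩, -⟩, rfl⟩
        exact h ⟨n, h1, h2⟩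
      simp only [mem_preimage, interfaceNormal, dif_neg h, mem_union, hx, false_or, mem_inter_iff,
        mem_compl_iff, not_false_eq_true, true_and, mem_ofPred_eq]
  rw [this]
  exact (hinj A hA).union ((hinj univ MeasurableSet.univ).compl.inter (MeasurableSet.const _))

/-! ### Finite surface measure of the boundary of a patch -/

theorem isCompact_closedCube (d : ℕ) : IsCompact (closedCube d) := by
  have h : closedCube d = (WithLp.toLp 2 : (Fin d → ℝ) → E d) '' (Set.pi univ fun _ => Icc 0 1) := by
    ext x
    refine ⟨fun hx => ⟨x.ofLp, fun k _ => hx k, rfl⟩, ?_⟩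
    rintro ⟨y, hy, rfl⟩ k
    exact hy k trivial
  rw [h]
  exact (isCompact_univ_pi fun _ => isCompact_Icc).image (PiLp.continuous_toLp 2 _)

theorem convex_closedCube (d : ℕ) : Convex ℝ (closedCube d) := by
  intro x hx y hy a b ha hb hab k
  exact convex_Icc 0 1 (hx k) (hy k) ha hb hab

theorem isOpen_openCube (d : ℕ) : IsOpen (openCube d) := by
  have : openCube d = ⋂ k, {x : E d | x k ∈ Ioo (0 : ℝ) 1} := by ext; simp [openCube]
  rw [this]
  exact isOpen_iInter_of_finite fun k => isOpen_Ioo.preimage (by fun_prop)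

/-- The embedding of `ℝ^n` into `ℝ^(n+1)` as the hyperplane `x k = a`. -/
def hyperplaneEmb {n : ℕ} (k : Fin (n + 1)) (a : ℝ) (x : E n) : E (n + 1) :=
  WithLp.toLp 2 (k.insertNth a x.ofLp : Fin (n + 1) → ℝ)

theorem isometry_hyperplaneEmb {n : ℕ} (k : Fin (n + 1)) (a : ℝ) :
    Isometry (hyperplaneEmb k a) := by
  refine Isometry.of_dist_eq fun x y => ?_
  rw [EuclideanSpace.dist_eq, EuclideanSpace.dist_eq, Fin.sum_univ_succAbove _ k]
  simp [hyperplaneEmb]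

/-- The boundary is covered by finitely many isometric copies of the cube of one dimension less, on
which the normalised Hausdorff measure is the Lebesgue measure. -/
theorem surf_closedCube_diff_openCube_lt_top {d : ℕ} (hd : 0 < d) :
    surf d (closedCube d \ openCube d) < ⊤ := by
  obtain ⟨n, rfl⟩ := Nat.exists_eq_succ_of_ne_zero hd.ne'
  have hsub : closedCube (n + 1) \ openCube (n + 1) ⊆ ⋃ q : Fin (n + 1) × Bool,
      hyperplaneEmb q.1 (if q.2 then 1 else 0) '' closedCube n := by
    rintro x ⟨hx, hx'⟩
    simp only [openCube, mem_ofPred_eq, not_forall] at hx'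
    obtain ⟨k, hk⟩ := hx'
    have hxk : ∃ b : Bool, x k = if b then 1 else 0 := by
      rcases (hx k).1.eq_or_lt with h | h
      · exact ⟨false, by simp [← h]⟩
      · rcases (hx k).2.eq_or_lt with h' | h'
        · exact ⟨true, by simp [h']⟩
        · exact absurd ⟨h, h'⟩ hk
    obtain ⟨b, hb⟩ := hxk
    refine mem_iUnion.2 ⟨(k, b), WithLp.toLp 2 (k.removeNth x.ofLp), fun j => hx (k.succAbove j), ?_⟩
    simp only [hyperplaneEmb, ← hb]
    rw [Fin.insertNth_self_removeNth]
  refine (measure_mono hsub).trans_lt ((measure_iUnion_le _).trans_lt ?_)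
  rw [tsum_fintype]
  refine ENNReal.sum_lt_top.2 fun q _ => ?_
  change (Measure.euclideanHausdorffMeasure n : Measure (E (n + 1))) _ < ⊤
  rw [(isometry_hyperplaneEmb _ _).euclideanHausdorffMeasure_image,
    EuclideanSpace.euclideanHausdorffMeasure_eq_volume]
  exact (isCompact_closedCube n).measure_lt_top

/-- By the inverse function theorem, since the determinant stays away from zero. -/
theorem Patch.isOpen_region {d p : ℕ} (P : Patch d p) : IsOpen P.region := by
  rw [isOpen_iff_mem_nhds]
  rintro _ ⟨x, hx, rfl⟩
  have hnhds : openCube d ∈ 𝓝 x := (isOpen_openCube d).mem_nhds hx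
  have hC : ContDiffAt ℝ 1 P.param x :=
    P.smooth.contDiffAt (mem_of_superset hnhds (openCube_subset_closedCube d))
  obtain ⟨c, C, hc, -, hdet⟩ := P.det_bounds
  have hne : (fderiv ℝ P.param x).det ≠ 0 := by
    intro h
    have := (hdet x hx).1
    rw [h, abs_zero] at this
    linarith
  have hs := hC.hasStrictFDerivAt (by norm_num)
  have hmap := HasStrictFDerivAt.map_nhds_eq_of_equiv
    (f' := (fderiv ℝ P.param x).toContinuousLinearEquivOfDetNeZero hne) (by simpa using hs)
  rw [← hmap]
  exact image_mem_map hnhds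

theorem Patch.frontier_subset {d p : ℕ} (P : Patch d p) :
    frontier P.region ⊆ P.param '' (closedCube d \ openCube d) := by
  rw [P.isOpen_region.frontier_eq]
  rintro y ⟨hy, hy'⟩
  have hc : IsClosed (P.param '' closedCube d) :=
    ((isCompact_closedCube d).image_of_continuousOn P.smooth.continuousOn).isClosed
  obtain ⟨x, hx, rfl⟩ :=
    closure_minimal (image_mono (openCube_subset_closedCube d)) hc hy
  exact ⟨x, ⟨hx, fun h => hy' ⟨x, h, rfl⟩⟩, rfl⟩

/-- The parametrization is `C¹` on a compact convex set, hence Lipschitz, and the frontier lies in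
the image of the boundary of the cube. Finite area makes square-integrable functions on interfaces
integrable. -/
theorem Patch.surf_frontier_lt_top {d p : ℕ} (hd : 0 < d) (P : Patch d p) :
    surf d (frontier P.region) < ⊤ := by
  obtain ⟨K, hK⟩ := P.smooth.exists_lipschitzOnWith one_ne_zero (convex_closedCube d)
    (isCompact_closedCube d)
  refine (measure_mono P.frontier_subset).trans_lt
    ((surf_image_le (hK.mono sdiff_subset)).trans_lt ?_)
  exact ENNReal.mul_lt_top (by finiteness) (surf_closedCube_diff_openCube_lt_top hd)

/-! ### Boundedness of the traces of splines -/

/-- The factors in the recursion are affine, hence bounded on the unit interval; a crude bound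
depending on the knots is enough, as it serves only for integrability. -/
theorem exists_forall_abs_bspline_le (ξ : ℕ → ℝ) (q : ℕ) :
    ∀ j, ∃ C, ∀ t ∈ Ioo (0 : ℝ) 1, |bspline ξ q j t| ≤ C := by
  induction q with
  | zero =>
    refine fun j => ⟨1, fun t _ => ?_⟩
    rw [bspline, indicator_apply]
    split_ifs <;> simp
  | succ q ih =>
    intro j
    obtain ⟨C₁, h₁⟩ := ih j
    obtain ⟨C₂, h₂⟩ := ih (j + 1)
    refine ⟨(1 + |ξ j|) / |ξ (j + q + 1) - ξ j| * C₁ +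
      (|ξ (j + q + 2)| + 1) / |ξ (j + q + 2) - ξ (j + 1)| * C₂, fun t ht => ?_⟩
    have habs : |t| ≤ 1 := abs_le.2 ⟨by linarith [ht.1], ht.2.le⟩
    rw [bspline]
    refine (abs_add_le _ _).trans ?_
    rw [abs_mul, abs_mul, abs_div, abs_div]
    gcongr
    · exact (abs_sub _ _).trans (by gcongr)
    · exact h₁ t ht
    · exact (abs_sub _ _).trans (by gcongr)
    · exact h₂ t ht

theorem exists_forall_abs_spline_le {d p : ℕ} (Ξ : Fin d → KnotVector p) (c : BIndex Ξ → ℝ) :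
    ∃ C, ∀ x ∈ openCube d, |spline Ξ c x| ≤ C := by
  choose C hC using fun k => exists_forall_abs_bspline_le (Ξ k).knot p
  refine ⟨∑ J : BIndex Ξ, (∏ k, C k (J k)) * |c J|, fun x hx => ?_⟩
  rw [spline]
  refine (Finset.abs_sum_le_sum_abs _ _).trans (Finset.sum_le_sum fun J _ => ?_)
  rw [smul_eq_mul, abs_mul, tensorBSpline, Finset.abs_prod]
  gcongr with k
  exact hC k (J k) _ (hx k)

theorem limUnder_eq_of_not_exists {X α : Type*} [TopologicalSpace X] [hX : Nonempty X]
    {l : Filter α} {f : α → X} (h : ¬∃ x, Tendsto f l (𝓝 x)) :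
    limUnder l f = Classical.choice hX := by
  change ¬∃ x, map f l ≤ 𝓝 x at h
  rw [limUnder, lim, Classical.epsilon, Classical.strongIndefiniteDescription, dif_neg h]

theorem exists_forall_abs_trace_le {d : ℕ} {U : Set (E d)} {f : E d → ℝ}
    {C : ℝ} (hC : ∀ x ∈ U, |f x| ≤ C) : ∃ C', ∀ x, |trace U f x| ≤ C' := by
  set C₁ := max C 0
  -- The single value that `limUnder` takes wherever the means do not converge; elsewhere the limit
  -- inherits the bound of the means.
  let z : ℝ := Classical.choice inferInstance
  refine ⟨max C₁ |z|, fun x => ?_⟩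
  by_cases h : ∃ y, Tendsto (fun n : ℕ => ⨍ y in Metric.ball x (1 / ((n : ℝ) + 1)) ∩ U, f y)
      atTop (𝓝 y)
  · refine le_max_of_le_left (le_of_tendsto (tendsto_nhds_limUnder h).abs
      (Eventually.of_forall fun n => ?_))
    set s := Metric.ball x (1 / ((n : ℝ) + 1)) ∩ U
    have hs : volume s < ⊤ := (measure_mono inter_subset_left).trans_lt measure_ball_lt_top
    have h1 : ‖∫ y in s, f y‖ ≤ C₁ * volume.real s :=
      norm_setIntegral_le_of_norm_le_const hs fun y hy => (hC y hy.2).trans (le_max_left _ _)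
    rw [setAverage_eq, smul_eq_mul, abs_mul, abs_of_nonneg (by positivity), ← Real.norm_eq_abs]
    calc _ ≤ (volume.real s)⁻¹ * (C₁ * volume.real s) := by gcongr
      _ = C₁ * ((volume.real s)⁻¹ * volume.real s) := by ring
      _ ≤ C₁ * 1 := by
        have : 0 ≤ C₁ := le_max_right _ _
        gcongr
        exact inv_mul_le_one
      _ = C₁ := mul_one _
  · rw [trace, limUnder_eq_of_not_exists h]
    exact le_max_right _ _

theorem Patch.IsSpline.exists_forall_abs_trace_le {d p : ℕ} {P : Patch d p} {f : E d → ℝ}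
    (hf : P.IsSpline f) : ∃ C, ∀ x, |trace P.region f x| ≤ C := by
  obtain ⟨c, hc⟩ := hf
  obtain ⟨C, hC⟩ := exists_forall_abs_spline_le P.knots c
  refine NonMatchingDG.exists_forall_abs_trace_le (C := C) ?_
  rintro _ ⟨x, hx, rfl⟩
  rw [hc x hx]
  exact hC x hx

/-! ### Matching interfaces -/

theorem integrableOn_of_surfSq_lt_top {d : ℕ} {F : Type} [NormedAddCommGroup F]
    [MeasurableSpace F] [BorelSpace F] [SecondCountableTopology F] {S : Set (E d)}
    (hS : surf d S < ⊤) {f : E d → F} (hf : Measurable f) (h : surfSq S f < ⊤) :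
    IntegrableOn f S (surf d) := by
  have : IsFiniteMeasure ((surf d).restrict S) := ⟨by rwa [Measure.restrict_apply_univ]⟩
  refine MemLp.integrable (q := 2) (by norm_num) ⟨hf.aestronglyMeasurable, ?_⟩
  rw [eLpNorm_lt_top_iff_lintegral_rpow_enorm_lt_top (by norm_num) (by norm_num)]
  simpa [surfSq] using h

namespace Decomposition

variable {d N p : ℕ} (D : Decomposition d N p)

/-- Exchanging the sides changes the sign of both the normal and the jump of `u`, so the two
contributions are the integrals of `q * φi` and `-(q * φj)` with the same `q`. Their sum sees only
the jump of the test function. -/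
theorem enorm_faceForm_add_swap_le {η m R : ℝ} (hη : 0 ≤ η) (hm : 0 < m) (hR : 0 < R)
    (hh : 0 < D.h) {S : Set (E d)} (hS : surf d S < ⊤) {n₁ n₂ : E d → E d} (mn : Measurable n₁)
    (hn : ∀ x, ‖n₁ x‖ ≤ 1) (hn₂ : ∀ x, n₂ x = -n₁ x) {ρi ρj a : ℝ}
    (hi : 0 ≤ ρi ∧ ρi ≤ R) (hj : 0 ≤ ρj ∧ ρj ≤ R) (ha : 0 ≤ a ∧ a ≤ R)
    {gi gj : E d → E d} {ui uj φi φj : E d → ℝ} (mgi : Measurable gi) (mgj : Measurable gj)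
    (mui : Measurable ui) (muj : Measurable uj) (mφi : Measurable φi) (mφj : Measurable φj)
    (bφi : ∃ C, ∀ x, |φi x| ≤ C) (bφj : ∃ C, ∀ x, |φj x| ≤ C) {X Y : ℝ≥0∞}
    (hgi : ENNReal.ofReal (m * D.h) * surfSq S gi ≤ X)
    (hgj : ENNReal.ofReal (m * D.h) * surfSq S gj ≤ X)
    (hu : ENNReal.ofReal (m / D.h) * surfSq S (fun x => ui x - uj x) ≤ X)
    (hφ : ENNReal.ofReal (m / D.h) * surfSq S (fun x => φi x - φj x) ≤ Y) :
    ‖D.faceForm η S n₁ ρi ρj a gi gj ui uj φi + D.faceForm η S n₂ ρj ρi a gj gi uj ui φj‖ₑ ≤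
      ENNReal.ofReal (R / m * (1 + 2 * η)) * (X ^ (1 / 2 : ℝ) * Y ^ (1 / 2 : ℝ)) := by
  set q : E d → ℝ := fun x => inner ℝ ((ρi / 2) • gi x + (ρj / 2) • gj x) (n₁ x) -
    η * a / D.h * (ui x - uj x) with hq
  have e1 : ∀ φ, D.faceForm η S n₁ ρi ρj a gi gj ui uj φ = ∫ x in S, q x * φ x ∂(surf d) := by
    intro φ
    simp only [faceForm, hq, sub_mul]
  have e2 : D.faceForm η S n₂ ρj ρi a gj gi uj ui φj = -∫ x in S, q x * φj x ∂(surf d) := by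
    rw [faceForm, ← integral_neg]
    refine integral_congr_ae (Eventually.of_forall fun x => ?_)
    simp only [hq, hn₂, inner_neg_right]
    rw [add_comm ((ρj / 2) • gj x)]
    ring
  have hK : 0 < R / m * (1 + 2 * η) := by positivity
  rw [e1, e2]
  -- If `Y = 0`, the right side is zero even for `X = ⊤`. The jump then vanishes almost everywhere,
  -- so the two integrals cancel without any integrability.
  rcases eq_or_ne Y 0 with hY | hY
  · have h0 : surfSq S (fun x => φi x - φj x) = 0 := by
      rw [hY, nonpos_iff_eq_zero, mul_eq_zero] at hφ
      exact hφ.resolve_left (by simp only [ENNReal.ofReal_eq_zero, not_le]; positivity)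
    rw [surfSq, lintegral_eq_zero_iff (by fun_prop)] at h0
    have : ∫ x in S, q x * φi x ∂(surf d) = ∫ x in S, q x * φj x ∂(surf d) := by
      refine integral_congr_ae ?_
      filter_upwards [h0] with x hx
      have hx' : φi x = φj x := by simpa [sub_eq_zero] using hx
      rw [hx']
    rw [this, add_neg_cancel, enorm_zero]
    exact zero_le
  rcases eq_or_ne X ⊤ with hX | hX
  · have hY' : Y ^ (1 / 2 : ℝ) ≠ 0 := by simp [hY]
    rw [hX, ENNReal.top_rpow_of_pos (by norm_num), ENNReal.top_mul hY',
      ENNReal.mul_top (by simpa using hK)]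
    exact le_top
  have fin : ∀ {A : ℝ≥0∞} {b : ℝ}, 0 < b → ENNReal.ofReal b * A ≤ X → A < ⊤ := by
    intro A b hb h
    rw [lt_top_iff_ne_top]
    rintro rfl
    rw [ENNReal.mul_top (by simpa using hb)] at h
    exact hX (top_le_iff.1 h)
  have igi := integrableOn_of_surfSq_lt_top hS mgi (fin (by positivity) hgi)
  have igj := integrableOn_of_surfSq_lt_top hS mgj (fin (by positivity) hgj)
  have iu := integrableOn_of_surfSq_lt_top hS (mui.sub muj) (fin (by positivity) hu)
  -- With `X` finite, fluxes and jump are square-integrable on a set of finite area, hence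
  -- integrable; bounded test functions preserve this.
  have iq : IntegrableOn q S (surf d) := by
    refine Integrable.sub ?_ (iu.const_mul _)
    have ig := (igi.smul (ρi / 2)).add (igj.smul (ρj / 2))
    refine ig.norm.mono' (by fun_prop) (Eventually.of_forall fun x => ?_)
    exact (norm_inner_le_norm _ _).trans (mul_le_of_le_one_right (norm_nonneg _) (hn x))
  have iφ : ∀ {φ : E d → ℝ}, Measurable φ → (∃ C, ∀ x, |φ x| ≤ C) →
      IntegrableOn (fun x => q x * φ x) S (surf d) := by
    rintro φ mφ ⟨C, hC⟩
    exact Integrable.mul_bdd (c := C) iq mφ.aestronglyMeasurable (Eventually.of_forall hC)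
  have e3 : ∫ x in S, q x * φi x ∂(surf d) + -∫ x in S, q x * φj x ∂(surf d) =
      D.faceForm η S n₁ ρi ρj a gi gj ui uj (fun x => φi x - φj x) := by
    rw [e1, ← sub_eq_add_neg, ← integral_sub (iφ mφi bφi) (iφ mφj bφj)]
    simp only [mul_sub]
  rw [e3]
  have h := D.enorm_faceForm_le (L := 1) hη hm le_rfl hh hn hi hj ha mgi.aemeasurable
    mgj.aemeasurable mui.aemeasurable muj.aemeasurable (mφi.sub mφj).aemeasurable
    (X := X) (Y := Y) (by simpa using hgi) (by simpa using hgj)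
    (hu.trans (le_mul_of_one_le_left' (by simp))) hφ
  rwa [mul_one] at h

/-! ### The individual contributions to `B_h` -/

theorem enorm_setIntegral_le {μ : Measure (E d)} {S : Set (E d)} {f : E d → ℝ}
    {F G : E d → ℝ≥0∞} (hF : AEMeasurable F (μ.restrict S)) (hG : AEMeasurable G (μ.restrict S))
    {a b c K : ℝ} (ha : 0 < a) (hb : 0 < b) (hc : 0 ≤ c) (hK : 0 ≤ K)
    (hcK : c ^ 2 ≤ K ^ 2 * (a * b)) {X Y : ℝ≥0∞}
    (hX : ENNReal.ofReal a * ∫⁻ x in S, F x ^ 2 ∂μ ≤ X)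
    (hY : ENNReal.ofReal b * ∫⁻ x in S, G x ^ 2 ∂μ ≤ Y)
    (hf : ∀ x, ‖f x‖ₑ ≤ ENNReal.ofReal c * (F x * G x)) :
    ‖∫ x in S, f x ∂μ‖ₑ ≤ ENNReal.ofReal K * (X ^ (1 / 2 : ℝ) * Y ^ (1 / 2 : ℝ)) := by
  refine (enorm_integral_le_lintegral_enorm _).trans ((lintegral_mono hf).trans ?_)
  rw [lintegral_const_mul' _ _ (by simp)]
  exact ofReal_mul_lintegral_mul_le hF hG ha hb hc hK zero_le_one (by simpa using hcK)
    (by simpa using hX) hY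

theorem frontier_le_fluxSq {ρ : Fin N → ℝ} (u : BrokenFun d N) (i : Fin N) :
    ENNReal.ofReal (ρ i * D.h) * surfSq (frontier (D.reg i)) (D.trGrad u i) ≤ D.fluxSq ρ u :=
  Finset.single_le_sum (f := fun i => ENNReal.ofReal (ρ i * D.h) *
    surfSq (frontier (D.reg i)) (D.trGrad u i)) (fun _ _ => zero_le) (Finset.mem_univ i)

theorem matching_le_dGSq {ρ : Fin N → ℝ} (u : BrokenFun d N) {i j : Fin N} (hij : j ≠ i) :
    ENNReal.ofReal (avg ρ i j / D.h) *
      surfSq (D.matching i j) (fun x => D.tr u i x - D.tr u j x) ≤ D.dGSq ρ u := by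
  unfold dGSq
  refine le_add_left (le_trans ?_ (Finset.single_le_sum (f := fun i =>
    ∑ j ∈ Finset.univ.erase i, ENNReal.ofReal (avg ρ i j / D.h) *
      surfSq (D.matching i j) (fun x => D.tr u i x - D.tr u j x))
    (fun _ _ => zero_le) (Finset.mem_univ i)))
  exact Finset.single_le_sum (f := fun j => ENNReal.ofReal (avg ρ i j / D.h) *
      surfSq (D.matching i j) (fun x => D.tr u i x - D.tr u j x))
    (fun _ _ => zero_le) (Finset.mem_erase.2 ⟨hij, Finset.mem_univ j⟩)

theorem matching_swap (i j : Fin N) : D.matching j i = D.matching i j := by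
  rw [matching, matching, inter_comm (frontier (D.reg j)), inter_comm (D.reg j)]

theorem matching_subset_left (i j : Fin N) : D.matching i j ⊆ frontier (D.reg i) :=
  fun _ hx => hx.1.1.1

theorem matching_subset_right (i j : Fin N) : D.matching i j ⊆ frontier (D.reg j) :=
  fun _ hx => hx.1.1.2

theorem measurableSet_reg (i : Fin N) : MeasurableSet (D.reg i) := (D.patch i).measurableSet_region

theorem enorm_patchForm_le {ρ : Fin N → ℝ} {η K : ℝ} (hη : 0 ≤ η) (hK : 1 ≤ K) (hηK : η ≤ K)
    (hh : 0 < D.h) {u φ : BrokenFun d N} (hu : D.AEMeas u) (hφ : D.AEMeas φ) (i : Fin N)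
    (hρ : 0 < ρ i) :
    ‖(∫ x in D.reg i, ρ i * inner ℝ (u.grad i x) (φ.grad i x)) -
      (∫ x in D.outerBdry i, ρ i * inner ℝ (D.trGrad u i x) (outerNormal (D.reg i) x) *
        D.tr φ i x ∂(surf d)) +
      η * ρ i / D.h * ∫ x in D.outerBdry i, D.tr u i x * D.tr φ i x ∂(surf d)‖ₑ ≤
      3 * (ENNReal.ofReal K * ((D.dGSq ρ u + D.fluxSq ρ u) ^ (1 / 2 : ℝ) *
        D.dGSq ρ φ ^ (1 / 2 : ℝ))) := by
  have h1K : 1 ≤ K ^ 2 := one_le_pow₀ hK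
  have mg := (hu.grad i).enorm
  have mgφ := (hφ.grad i).enorm
  have mt := hu.measurable_tr i
  have mtφ := hφ.measurable_tr i
  have mtg := hu.measurable_trGrad i
  have a1 : ‖∫ x in D.reg i, ρ i * inner ℝ (u.grad i x) (φ.grad i x)‖ₑ ≤ _ :=
    enorm_setIntegral_le (X := D.dGSq ρ u + D.fluxSq ρ u) (Y := D.dGSq ρ φ) mg mgφ (c := ρ i)
      (K := K) hρ hρ hρ.le (by linarith) (by nlinarith [mul_pos hρ hρ])
      (le_add_right (D.volSq_le_dGSq u i)) (D.volSq_le_dGSq φ i) (fun x => by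
        simp only [← ofReal_norm, ← ENNReal.ofReal_mul (norm_nonneg _)]
        rw [← ENNReal.ofReal_mul hρ.le]
        refine ENNReal.ofReal_le_ofReal ?_
        rw [norm_mul, Real.norm_of_nonneg hρ.le]
        gcongr
        exact norm_inner_le_norm _ _)
  have a2 : ‖∫ x in D.outerBdry i, ρ i * inner ℝ (D.trGrad u i x) (outerNormal (D.reg i) x) *
        D.tr φ i x ∂(surf d)‖ₑ ≤ _ :=
    enorm_setIntegral_le (X := D.dGSq ρ u + D.fluxSq ρ u) (Y := D.dGSq ρ φ)
      mtg.enorm.aemeasurable mtφ.enorm.aemeasurable (a := ρ i * D.h) (b := ρ i / D.h) (c := ρ i)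
      (K := K) (by positivity) (by positivity) hρ.le (by linarith)
      (by
        have : ρ i * D.h * (ρ i / D.h) = ρ i ^ 2 := by field_simp
        rw [this]; nlinarith [mul_pos hρ hρ])
      (le_add_left (le_trans (by gcongr; exact surfSq_mono inter_subset_left _)
        (D.frontier_le_fluxSq u i)))
      (D.outerBdry_le_dGSq φ i) (fun x => by
        simp only [← ofReal_norm, ← ENNReal.ofReal_mul (norm_nonneg _)]
        rw [← ENNReal.ofReal_mul hρ.le]
        refine ENNReal.ofReal_le_ofReal ?_
        rw [norm_mul, norm_mul, Real.norm_of_nonneg hρ.le, mul_assoc]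
        gcongr
        exact (norm_inner_le_norm _ _).trans
          (mul_le_of_le_one_right (norm_nonneg _) (norm_outerNormal_le _ _)))
  have a3 : ‖η * ρ i / D.h * ∫ x in D.outerBdry i, D.tr u i x * D.tr φ i x ∂(surf d)‖ₑ ≤
      ENNReal.ofReal K * ((D.dGSq ρ u + D.fluxSq ρ u) ^ (1 / 2 : ℝ) *
        D.dGSq ρ φ ^ (1 / 2 : ℝ)) := by
    rw [← integral_const_mul]
    exact enorm_setIntegral_le (X := D.dGSq ρ u + D.fluxSq ρ u) (Y := D.dGSq ρ φ)
      mt.enorm.aemeasurable mtφ.enorm.aemeasurable (a := ρ i / D.h) (b := ρ i / D.h)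
      (c := η * ρ i / D.h) (K := K) (by positivity) (by positivity) (by positivity) (by linarith)
      (by
        have : (η * ρ i / D.h) ^ 2 = η ^ 2 * (ρ i / D.h * (ρ i / D.h)) := by ring
        rw [this]; gcongr)
      (le_add_right (D.outerBdry_le_dGSq u i))
      (D.outerBdry_le_dGSq φ i) (fun x => by
        rw [enorm_mul, enorm_mul, Real.enorm_of_nonneg (by positivity)])
  refine (enorm_add_le _ _).trans ((add_le_add (enorm_sub_le.trans (add_le_add a1 a2))
    a3).trans (le_of_eq ?_))
  ring

theorem trGrad_le {ρ : Fin N → ℝ} {m : ℝ} (u : BrokenFun d N) {S : Set (E d)} {i : Fin N} (hS : S ⊆ frontier (D.reg i)) (hmρ : m ≤ ρ i)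
    (hh : 0 < D.h) :
    ENNReal.ofReal (m * D.h) * surfSq S (D.trGrad u i) ≤ D.dGSq ρ u + D.fluxSq ρ u := by
  refine le_add_left (le_trans ?_ (D.frontier_le_fluxSq u i))
  gcongr
  exact surfSq_mono hS _

theorem ofReal_div_mul_le {m a h : ℝ} (hma : m ≤ a) (hh : 0 < h) {A Z : ℝ≥0∞}
    (hA : ENNReal.ofReal (a / h) * A ≤ Z) : ENNReal.ofReal (m / h) * A ≤ Z :=
  le_trans (by gcongr) hA

theorem enorm_gapForm_le {ρ : Fin N → ℝ} {η m R : ℝ} {M : ℝ≥0} (hη : 0 ≤ η) (hm : 0 < m)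
    (hmρ : ∀ i, m ≤ ρ i) (hρR : ∀ i, ρ i ≤ R) (hh : 0 < D.h) (hM : D.SlopeLE M)
    {u φ : BrokenFun d N} (hu : D.AEMeas u) (hφ : D.AEMeas φ) {e : Fin N × Fin N}
    (he : e ∈ D.gaps) :
    ‖D.faceForm η (D.gapFaces e).base (outerNormal (D.reg e.1)) (ρ e.1) (ρ e.2) (gapAvgBase ρ e)
        (D.trGrad u e.1) (D.trGrad u e.2 ∘ (D.gapFaces e).toOpp)
        (D.tr u e.1) (D.tr u e.2 ∘ (D.gapFaces e).toOpp) (D.tr φ e.1) +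
      D.faceForm η (D.gapFaces e).opp (outerNormal (D.reg e.2)) (ρ e.2) (ρ e.1) (gapAvgOpp ρ e)
        (D.trGrad u e.2) (D.trGrad u e.1 ∘ (D.gapFaces e).toBase)
        (D.tr u e.2) (D.tr u e.1 ∘ (D.gapFaces e).toBase) (D.tr φ e.2)‖ₑ ≤
      2 * (ENNReal.ofReal (R / m * (1 + 2 * η) * (1 + M) ^ (d - 1)) *
        ((D.dGSq ρ u + D.fluxSq ρ u) ^ (1 / 2 : ℝ) * D.dGSq ρ φ ^ (1 / 2 : ℝ))) := by
  have hL := hM.1 e he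
  have hcb := D.gap_compact e he
  -- Compactness of the planar face makes the opposite face compact, hence Borel.
  have hco : IsCompact (D.gapFaces e).opp := hcb.image_of_continuousOn
    ((D.gapFaces e).lipschitzOnWith_toOpp hL).continuousOn
  have h1 := hmρ e.1
  have h2 := hmρ e.2
  have h1' := hρR e.1
  have h2' := hρR e.2
  have hb : m ≤ gapAvgBase ρ e ∧ gapAvgBase ρ e ≤ R := by
    constructor <;> rw [gapAvgBase] <;> linarith
  have ho : m ≤ gapAvgOpp ρ e ∧ gapAvgOpp ρ e ≤ R := by
    constructor <;> rw [gapAvgOpp] <;> linarith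
  have gu := D.gap_le_dGSq (ρ := ρ) u he
  have gφ := D.gap_le_dGSq (ρ := ρ) φ he
  exact D.enorm_faceForm_opposite_le hη hm hh (D.gapFaces e) hcb.measurableSet hco.measurableSet hL
    (norm_outerNormal_le _) (norm_outerNormal_le _) ⟨by linarith, h1'⟩ ⟨by linarith, h2'⟩
    ⟨by linarith, hb.2⟩ ⟨by linarith, ho.2⟩
    (hu.measurable_trGrad _) (hu.measurable_trGrad _) (hu.measurable_tr _) (hu.measurable_tr _)
    (hφ.measurable_tr _) (hφ.measurable_tr _)
    (D.trGrad_le u (D.gap_base e he) h1 hh) (D.trGrad_le u (D.gap_opp e he) h2 hh)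
    (le_add_right (ofReal_div_mul_le hb.1 hh (le_self_add.trans gu)))
    (le_add_right (ofReal_div_mul_le ho.1 hh (le_add_self.trans gu)))
    (ofReal_div_mul_le hb.1 hh (le_self_add.trans gφ))
    (ofReal_div_mul_le ho.1 hh (le_add_self.trans gφ))

theorem enorm_overlapForm_le {ρ : Fin N → ℝ} {η m R : ℝ} {M : ℝ≥0} (hη : 0 ≤ η) (hm : 0 < m)
    (hmρ : ∀ i, m ≤ ρ i) (hρR : ∀ i, ρ i ≤ R) (hh : 0 < D.h) (hM : D.SlopeLE M)
    {u φ : BrokenFun d N} (hu : D.AEMeas u) (hφ : D.AEMeas φ) {e : Fin N × Fin N}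
    (he : e ∈ D.overlaps) :
    ‖D.faceForm η (D.overlapFaces e).base (outerNormal (D.reg e.1)) (ρ e.1) (ρ e.2)
        (avg ρ e.1 e.2)
        (D.trGrad u e.1) (D.trGrad u e.2 ∘ (D.overlapFaces e).toOpp)
        (D.tr u e.1) (D.tr u e.2 ∘ (D.overlapFaces e).toOpp) (D.tr φ e.1) +
      D.faceForm η (D.overlapFaces e).opp (outerNormal (D.reg e.2)) (ρ e.2) (ρ e.1)
        (avg ρ e.1 e.2)
        (D.trGrad u e.2) (D.trGrad u e.1 ∘ (D.overlapFaces e).toBase)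
        (D.tr u e.2) (D.tr u e.1 ∘ (D.overlapFaces e).toBase) (D.tr φ e.2)‖ₑ ≤
      2 * (ENNReal.ofReal (R / m * (1 + 2 * η) * (1 + M) ^ (d - 1)) *
        ((D.dGSq ρ u + D.fluxSq ρ u) ^ (1 / 2 : ℝ) * D.dGSq ρ φ ^ (1 / 2 : ℝ))) := by
  have hbase := D.overlap_base e he
  have hopp := D.overlap_opp e he
  have h1 := hmρ e.1
  have h2 := hmρ e.2
  have h1' := hρR e.1
  have h2' := hρR e.2
  have ha : m ≤ avg ρ e.1 e.2 ∧ avg ρ e.1 e.2 ≤ R := by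
    constructor <;> rw [avg] <;> linarith
  have gu := D.overlap_le_dGSq (ρ := ρ) u he
  have gφ := D.overlap_le_dGSq (ρ := ρ) φ he
  have mb : MeasurableSet (D.overlapFaces e).base :=
    hbase ▸ isClosed_frontier.measurableSet.inter (D.measurableSet_reg e.2)
  have mo : MeasurableSet (D.overlapFaces e).opp :=
    hopp ▸ isClosed_frontier.measurableSet.inter (D.measurableSet_reg e.1)
  exact D.enorm_faceForm_opposite_le hη hm hh (D.overlapFaces e) mb mo (hM.2 e he)
    (norm_outerNormal_le _) (norm_outerNormal_le _) ⟨by linarith, h1'⟩ ⟨by linarith, h2'⟩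
    ⟨by linarith, ha.2⟩ ⟨by linarith, ha.2⟩
    (hu.measurable_trGrad _) (hu.measurable_trGrad _) (hu.measurable_tr _) (hu.measurable_tr _)
    (hφ.measurable_tr _) (hφ.measurable_tr _)
    (D.trGrad_le u (hbase.trans_subset inter_subset_left) h1 hh)
    (D.trGrad_le u (hopp.trans_subset inter_subset_left) h2 hh)
    (le_add_right (ofReal_div_mul_le ha.1 hh (le_self_add.trans gu)))
    (le_add_right (ofReal_div_mul_le ha.1 hh (le_add_self.trans gu)))
    (ofReal_div_mul_le ha.1 hh (le_self_add.trans gφ))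
    (ofReal_div_mul_le ha.1 hh (le_add_self.trans gφ))

/-- The contribution to `B_h` of the side of the patch `i` of the matching interface `(i, j)`. -/
def matchingForm (ρ : Fin N → ℝ) (η : ℝ) (u φ : BrokenFun d N) (i j : Fin N) : ℝ :=
  D.faceForm η (D.matching i j) (interfaceNormal (D.reg i) (D.reg j)) (ρ i) (ρ j) (avg ρ i j)
    (D.trGrad u i) (D.trGrad u j) (D.tr u i) (D.tr u j) (D.tr φ i)

theorem enorm_matchingForm_add_swap_le {ρ : Fin N → ℝ} {η m R : ℝ} (hd : 0 < d) (hη : 0 ≤ η)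
    (hm : 0 < m) (hmρ : ∀ i, m ≤ ρ i) (hρR : ∀ i, ρ i ≤ R) (hh : 0 < D.h)
    {u : BrokenFun d N} (hu : D.AEMeas u) {φ : Fin N → E d → ℝ} (hφ : D.MemVh φ)
    {i j : Fin N} (hij : j ≠ i) :
    ‖D.matchingForm ρ η u (BrokenFun.ofSpline φ) i j +
      D.matchingForm ρ η u (BrokenFun.ofSpline φ) j i‖ₑ ≤
      ENNReal.ofReal (R / m * (1 + 2 * η)) * ((D.dGSq ρ u + D.fluxSq ρ u) ^ (1 / 2 : ℝ) *
        D.dGSq ρ (BrokenFun.ofSpline φ) ^ (1 / 2 : ℝ)) := by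
  have h1 := hmρ i
  have h2 := hmρ j
  have h1' := hρR i
  have h2' := hρR j
  have ha : m ≤ avg ρ i j ∧ avg ρ i j ≤ R := by
    constructor <;> rw [avg] <;> linarith
  have hswap : avg ρ j i = avg ρ i j := by rw [avg, avg, add_comm]
  have hmφ := hφ.aemeas
  rw [matchingForm, matchingForm, D.matching_swap i j, hswap]
  exact D.enorm_faceForm_add_swap_le hη hm (by linarith) hh
    ((measure_mono (D.matching_subset_left i j)).trans_lt ((D.patch i).surf_frontier_lt_top hd))
    (measurable_interfaceNormal _ _) (norm_interfaceNormal_le _ _) (interfaceNormal_swap _ _)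
    ⟨by linarith, h1'⟩ ⟨by linarith, h2'⟩ ⟨by linarith, ha.2⟩
    (hu.measurable_trGrad _) (hu.measurable_trGrad _) (hu.measurable_tr _) (hu.measurable_tr _)
    (hmφ.measurable_tr _) (hmφ.measurable_tr _)
    (hφ i).exists_forall_abs_trace_le (hφ j).exists_forall_abs_trace_le
    (D.trGrad_le u (D.matching_subset_left i j) h1 hh)
    (D.trGrad_le u (D.matching_subset_right i j) h2 hh)
    (le_add_right (ofReal_div_mul_le ha.1 hh (D.matching_le_dGSq u hij)))
    (ofReal_div_mul_le ha.1 hh (D.matching_le_dGSq _ hij))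

/-- Symmetrization: only the sums of the two sides of an interface are controlled, and twice the sum
over ordered pairs consists of such sums. -/
theorem enorm_sum_offDiag_le {T : Fin N → Fin N → ℝ} {B : ℝ≥0∞}
    (hT : ∀ i j, j ≠ i → ‖T i j + T j i‖ₑ ≤ B) :
    ‖∑ i, ∑ j ∈ Finset.univ.erase i, T i j‖ₑ ≤ N * (N * B) := by
  set S := ∑ i, ∑ j ∈ Finset.univ.erase i, T i j
  have hS : S = ∑ i, ∑ j ∈ Finset.univ.erase i, T j i :=
    Finset.sum_comm' (by simp [ne_comm])
  have h2 : S + S = ∑ i, ∑ j ∈ Finset.univ.erase i, (T i j + T j i) := by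
    simp_rw [Finset.sum_add_distrib]
    rw [← hS]
  have h3 : ‖S‖ₑ ≤ ‖S + S‖ₑ := by
    rw [← two_mul, enorm_mul]
    refine le_mul_of_one_le_left' ?_
    rw [Real.enorm_of_nonneg (by norm_num)]
    simp
  refine h3.trans (h2 ▸ (enorm_sum_le _ _).trans ?_)
  calc _ ≤ ∑ _i : Fin N, ∑ _j : Fin N, B := by
        gcongr with i
        refine (enorm_sum_le _ _).trans ((Finset.sum_le_sum fun j hj => ?_).trans
          (Finset.sum_le_sum_of_subset (Finset.erase_subset i Finset.univ)))
        exact hT i j (Finset.ne_of_mem_erase hj)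
    _ = N * (N * B) := by simp

/-- The count `3 * N + 5 * N ^ 2` comes from three terms per patch, two faces for each of at most `N
^ 2` gaps and as many overlaps, and `N ^ 2` for the matching interfaces. -/
theorem enorm_Bh_le {ρ : Fin N → ℝ} {η m R : ℝ} {M : ℝ≥0} (hd : 0 < d) (hη : 0 ≤ η) (hm : 0 < m)
    (hmR : m ≤ R) (hmρ : ∀ i, m ≤ ρ i) (hρR : ∀ i, ρ i ≤ R) (hM : D.SlopeLE M)
    {u : BrokenFun d N} (hu : D.AEMeas u) {φ : Fin N → E d → ℝ} (hφ : D.MemVh φ) :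
    ‖D.Bh ρ η u (BrokenFun.ofSpline φ)‖ₑ ≤
      ((3 * N + 5 * N ^ 2 : ℕ) : ℝ≥0∞) *
        (ENNReal.ofReal (R / m * (1 + 2 * η) * (1 + M) ^ (d - 1)) *
          ((D.dGSq ρ u + D.fluxSq ρ u) ^ (1 / 2 : ℝ) *
            D.dGSq ρ (BrokenFun.ofSpline φ) ^ (1 / 2 : ℝ))) := by
  -- Without patches `D.h` is a supremum over the empty set, hence zero, but then `B_h` is an empty
  -- sum.
  rcases Nat.eq_zero_or_pos N with rfl | hN
  · simp [Bh, Finset.eq_empty_of_isEmpty]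
  have hh : 0 < D.h := D.h_pos hd ⟨0, hN⟩
  have hR : 0 < R := hm.trans_le hmR
  set Z := (D.dGSq ρ u + D.fluxSq ρ u) ^ (1 / 2 : ℝ) *
    D.dGSq ρ (BrokenFun.ofSpline φ) ^ (1 / 2 : ℝ)
  set K := R / m * (1 + 2 * η) * (1 + M) ^ (d - 1) with hKdef
  have hRm : 1 ≤ R / m := (one_le_div hm).2 hmR
  have hL : (1 : ℝ) ≤ (1 + M) ^ (d - 1) := one_le_pow₀ (by simp)
  have hK0 : R / m * (1 + 2 * η) ≤ K := le_mul_of_one_le_right (by positivity) hL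
  have hK1 : 1 + 2 * η ≤ K := (le_mul_of_one_le_left (by positivity) hRm).trans hK0
  have hcard : ∀ s : Finset (Fin N × Fin N), (s.card : ℝ≥0∞) ≤ N ^ 2 := by
    intro s
    have := s.card_le_univ
    rw [Fintype.card_prod, Fintype.card_fin, ← sq] at this
    exact_mod_cast this
  have hpairs : ∀ (s : Finset (Fin N × Fin N)) (f : Fin N × Fin N → ℝ),
      (∀ e ∈ s, ‖f e‖ₑ ≤ 2 * (ENNReal.ofReal K * Z)) →
      ‖∑ e ∈ s, f e‖ₑ ≤ N ^ 2 * (2 * (ENNReal.ofReal K * Z)) := by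
    intro s f hf
    refine (enorm_sum_le _ _).trans ((Finset.sum_le_card_nsmul _ _ _ hf).trans ?_)
    rw [nsmul_eq_mul]
    gcongr
    exact hcard s
  have b1 := (enorm_sum_le Finset.univ _).trans (Finset.sum_le_sum fun i _ =>
    D.enorm_patchForm_le hη (by linarith) (by linarith : η ≤ K) hh hu hφ.aemeas i
      (hm.trans_le (hmρ i)))
  have b2 := hpairs D.gaps _ fun e he => D.enorm_gapForm_le hη hm hmρ hρR hh hM hu hφ.aemeas he
  have b3 := hpairs D.overlaps _ fun e he =>
    D.enorm_overlapForm_le hη hm hmρ hρR hh hM hu hφ.aemeas he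
  have b4 := enorm_sum_offDiag_le (T := D.matchingForm ρ η u (BrokenFun.ofSpline φ))
    (B := ENNReal.ofReal K * Z) fun i j hij =>
      (D.enorm_matchingForm_add_swap_le hd hη hm hmρ hρR hh hu hφ hij).trans (by gcongr)
  unfold Bh
  refine (enorm_sub_le.trans (add_le_add (enorm_sub_le.trans (add_le_add (enorm_sub_le.trans
    (add_le_add b1 b2)) b3)) b4)).trans (le_of_eq ?_)
  simp only [Finset.sum_const, Finset.card_univ, Fintype.card_fin, nsmul_eq_mul]
  push_cast
  ring

end Decomposition

end NonMatchingDG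
end

/-! ### The main theorem -/

open NonMatchingDG

theorem mainTheorem3 (d : ℕ) (hd : d = 2 ∨ d = 3) (N : ℕ) (ρ : Fin N → ℝ) (hρ : ∀ i, 0 < ρ i)
    (η : ℝ) (hη : 0 < η) (M : ℝ≥0) :
    ∃ C : ℝ, 0 ≤ C ∧
      ∀ (p : ℕ) (D : Decomposition d N p) (lam : ℝ),
        D.SlopeLE M → 1 ≤ lam → D.WidthLE (D.h ^ lam) →
        ∀ (ℓ : ℕ), 2 ≤ ℓ →
        ∀ (v : Fin N → E d → ℝ) (vg : Fin N × Fin N → E d → ℝ) (w φ : Fin N → E d → ℝ),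
          D.MemVstar ℓ v vg → D.MemVh w → D.MemVh φ →
          ENNReal.ofReal (D.Bh ρ η (D.sum v w) (BrokenFun.ofSpline φ)) ≤
            ENNReal.ofReal C *
              ((D.dGSq ρ (D.sum v w) + D.fluxSq ρ (D.sum v w)) ^ (1 / 2 : ℝ) +
                D.Kgo v vg * ENNReal.ofReal (D.h ^ (lam + 1) + D.h ^ (lam - 1 / 2))) *
              D.dGSq ρ (BrokenFun.ofSpline φ) ^ (1 / 2 : ℝ) := by
  have hd0 : 0 < d := by omega
  obtain ⟨m, R, hm, hmR, hmρ, hρR⟩ :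
      ∃ m R : ℝ, 0 < m ∧ m ≤ R ∧ (∀ i, m ≤ ρ i) ∧ ∀ i, ρ i ≤ R := by
    have hinv : ∀ i, 0 ≤ (ρ i)⁻¹ := fun i => (inv_pos.2 (hρ i)).le
    have hs : 0 ≤ ∑ i, (ρ i)⁻¹ := Finset.sum_nonneg fun i _ => hinv i
    have hs' : 0 ≤ ∑ i, ρ i := Finset.sum_nonneg fun i _ => (hρ i).le
    -- Bounds of the coefficients that depend on `ρ` alone; sums replace minimum and maximum so that
    -- `N = 0` needs no special treatment.
    refine ⟨(1 + ∑ i, (ρ i)⁻¹)⁻¹, 1 + ∑ i, ρ i, by positivity,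
      (inv_le_one_of_one_le₀ (by linarith)).trans (by linarith), fun i => ?_, fun i => ?_⟩
    · refine inv_le_of_inv_le₀ (hρ i) ?_
      have := Finset.single_le_sum (fun j _ => hinv j) (Finset.mem_univ i)
      linarith
    · have := Finset.single_le_sum (fun j _ => (hρ j).le) (Finset.mem_univ i)
      linarith
  have hK : 0 ≤ R / m * (1 + 2 * η) * (1 + M) ^ (d - 1) := by
    have := hm.trans_le hmR
    positivity
  refine ⟨((3 * N + 5 * N ^ 2 : ℕ) : ℝ) * (R / m * (1 + 2 * η) * (1 + M) ^ (d - 1)),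
    by positivity, ?_⟩
  intro p D lam hM _ _ ℓ _ v vg w φ hv hw hφ
  refine (Real.ofReal_le_enorm _).trans
    ((D.enorm_Bh_le hd0 hη.le hm hmR hmρ hρR hM (hv.aemeas_sum hw) hφ).trans ?_)
  rw [ENNReal.ofReal_mul (Nat.cast_nonneg _), ENNReal.ofReal_natCast, ← mul_assoc, ← mul_assoc]
  gcongr
  -- The bound already holds without the residual term, which is nonnegative.
  exact le_self_add
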